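/- Let $\mathfrak g$ be a finite-dimensional complex reductive Lie algebra with a triangular decomposition $\mathfrak g=\mathfrak n^-\oplus\mathfrak h\oplus\mathfrak n^+$ ($\mathfrak h$ a Cartan subalgebra, $\mathfrak n^{\pm}$ the sums of the positive, resp. negative, root spaces). Let $\mathfrak g_0\subset\mathfrak g$ be a subalgebra normalised by $\mathfrak h$ that is reductive and whose centre consists of $\mathrm{ad}_{\mathfrak g}$-semisimple elements. Put $\mathfrak h_0=\mathfrak h\cap\mathfrak g_0$, $\mathfrak n_0^{\pm}=\mathfrak n^{\pm}\cap\mathfrak g_0$, and let $\mathfrak n^-=\mathfrak n_0^-\oplus\mathfrak r$ with $\mathfrak r$ an $\mathfrak h$-stable subspace. Fix ordered bases of $\mathfrak n_0^-$ and of $\mathfrak r$ consisting of root vectors. A monomial in the basis of $\mathfrak n^-$ is written $m=m_0m_1$, with $m_0$ a monomial in the basis of $\mathfrak n_0^-$ and $m_1$ one in the basis of $\mathfrak r$; it is identified with the ordered product in $\mathcal U(\mathfrak n^-)$ in which the factors from $\mathfrak n_0^-$ come first, followed by those from $\mathfrak r$, each group in its chosen order. A monomial order is a total order on monomials with $1\le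 m$ for all $m$ that is compatible with multiplication. Fix monomial orders on the monomials $m_0$ and on the monomials $m_1$, and order the monomials of $\mathfrak n^-$ by the branching order: $m_0m_1<m_0'm_1'$ if and only if $m_1<m_1'$, or $m_1=m_1'$ and $m_0<m_0'$. For a finite-dimensional irreducible $\mathfrak g$-module $V(\lambda)$ with highest weight vector $v_\lambda$ of weight $\lambda$, a monomial $m$ is essential for $\lambda$ if $mv_\lambda$ does not lie in the linear span of the vectors $\tilde mv_\lambda$ with $\tilde m<m$; let $\mathrm{ess}(\lambda)$ be the set of essential monomials. For a finite-dimensional irreducible $\mathfrak g_0$-module of highest weight $\mu\in\mathfrak h_0^*$ (with respect to $\mathfrak h_0$ and $\mathfrak n_0^+$), the set $\mathrm{ess}(\mu)$ of monomials $m_0$ is defined in the same way, with the chosen basis of $\mathfrak n_0^-$, its sequence of factors and the chosen order on the monomials $m_0$. The branching semigroup is $$\Gamma_{\mathfrak g\downarrow\mathfrak g_0}=\{(\lambda,m_1)\mid \lambda \text{ dominant},\ m_1 \text{ a monomial in the basis of } \mathfrak r,\ m_1\in\mathrm{ess}(\lambda)\},$$ and $\Gamma_{\mathfrak g\downarrow\mathfrak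 g_0}(\lambda)=\{m_1\mid(\lambda,m_1)\in\Gamma_{\mathfrak g\downarrow\mathfrak g_0}\}$; here a weight $\lambda$ is dominant if it is the highest weight of a finite-dimensional irreducible $\mathfrak g$-module. Assume that for every dominant weight $\lambda$, every monomial $m_1\ne 1$ in the basis of $\mathfrak r$ and every $x\in\mathfrak n_0^+$, the vector $x m_1v_\lambda$ lies in the linear span of the vectors $\tilde mv_\lambda$, where $\tilde m$ runs over the monomials in the basis of $\mathfrak n^-$ with $\tilde m<m_1$. Then for every dominant weight $\lambda$ and all monomials $m_0$ in the basis of $\mathfrak n_0^-$ and $m_1$ in the basis of $\mathfrak r$, one has $m_0m_1\in\mathrm{ess}(\lambda)$ if and only if $m_1\in\Gamma_{\mathfrak g\downarrow\mathfrak g_0}(\lambda)$ and $m_0\in\mathrm{ess}(\mu)$, where $\mu$ is the $\mathfrak h_0$-weight of the vector $m_1v_\lambda$ (which is nonzero when $m_1\in\Gamma_{\mathfrak g\downarrow\mathfrak g_0}(\lambda)$). -/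

import Mathlib

universe u w

open scoped MonomialOrder

noncomputable section

namespace FFLVBranching

section Roots

variable {𝔤 : Type u} [LieRing 𝔤] [LieAlgebra ℂ 𝔤] [FiniteDimensional ℂ 𝔤]
variable (H : LieSubalgebra ℂ 𝔤) [H.IsCartanSubalgebra]

/-- `P` is a system of positive roots: it consists of the roots that are positive on some element
of the Cartan subalgebra on which all roots take nonzero real values. -/
def IsPositiveSystem (P : Set (LieModule.Weight ℂ H 𝔤)) : Prop :=
  ∃ t : H, ∀ α : LieModule.Weight ℂ H 𝔤,
    (α.IsNonZero → (α t).im = 0 ∧ (α t).re ≠ 0) ∧ (α ∈ P ↔ α.IsNonZero ∧ 0 < (α t).re)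

/-- The negative roots: the roots that are not positive. -/
def negRoots (P : Set (LieModule.Weight ℂ H 𝔤)) : Set (LieModule.Weight ℂ H 𝔤) :=
  {α | α.IsNonZero ∧ α ∉ P}

/-- The sum of the root spaces over a set of roots. For a positive system `P` this gives
`𝔫⁺` on `P` and `𝔫⁻` on `negRoots H P`. -/
def rootSum (P : Set (LieModule.Weight ℂ H 𝔤)) : Submodule ℂ 𝔤 :=
  ⨆ α ∈ P, (LieAlgebra.rootSpace H α).toSubmodule

/-- `𝔫⁺`. -/
def nPos (P : Set (LieModule.Weight ℂ H 𝔤)) : Submodule ℂ 𝔤 := rootSum H P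

/-- `𝔫⁻`. -/
def nNeg (P : Set (LieModule.Weight ℂ H 𝔤)) : Submodule ℂ 𝔤 := rootSum H (negRoots H P)

/-- `f` is a basis of the subspace `n` consisting of negative root vectors. -/
structure IsRootVectorBasis {ι : Type*} (P : Set (LieModule.Weight ℂ H 𝔤))
    (n : Submodule ℂ 𝔤) (f : ι → 𝔤) : Prop where
  linearIndependent : LinearIndependent ℂ f
  span_eq : Submodule.span ℂ (Set.range f) = n
  root_vector : ∀ i, ∃ α ∈ negRoots H P, f i ∈ LieAlgebra.rootSpace H α

end Roots

section Subalgebra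

variable {𝔤 : Type u} [LieRing 𝔤] [LieAlgebra ℂ 𝔤]

/-- A reductive subalgebra: it is reductive as a Lie algebra and its centre consists of elements
that act semisimply on `𝔤` in the adjoint representation. -/
structure IsReductiveSubalgebra (𝔤₀ : LieSubalgebra ℂ 𝔤) : Prop where
  reductive : LieAlgebra.HasCentralRadical ℂ 𝔤₀
  center_semisimple : ∀ z ∈ LieAlgebra.center ℂ 𝔤₀, (LieAlgebra.ad ℂ 𝔤 (z : 𝔤)).IsSemisimple

/-- `𝔥₀ = 𝔥 ∩ 𝔤₀`, as a subalgebra of `𝔤₀`. -/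
def cartan₀ (H 𝔤₀ : LieSubalgebra ℂ 𝔤) : LieSubalgebra ℂ 𝔤₀ := H.comap 𝔤₀.incl

/-- `n ∩ 𝔤₀`, as a subspace of `𝔤₀`. -/
def inter₀ (n : Submodule ℂ 𝔤) (𝔤₀ : LieSubalgebra ℂ 𝔤) : Submodule ℂ 𝔤₀ :=
  n.comap 𝔤₀.toSubmodule.subtype

end Subalgebra

section Modules

variable {L : Type u} [LieRing L] [LieAlgebra ℂ L]
variable {V : Type w} [AddCommGroup V] [Module ℂ V] [LieRingModule L V] [LieModule ℂ L V]

/-- `v` is a (nonzero) weight vector of weight `μ` for the subalgebra `H`. -/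
def IsWeightVector (H : LieSubalgebra ℂ L) (μ : Module.Dual ℂ H) (v : V) : Prop :=
  v ≠ 0 ∧ ∀ x : H, ⁅(x : L), v⁆ = μ x • v

/-- `V` is a finite-dimensional irreducible `L`-module and `v` is a highest weight vector in it, of
weight `lam` for `H`, with respect to the space `n` of raising operators. The weights `lam`
for which such a pair exists are the dominant weights. -/
structure IsHighestWeightModule (H : LieSubalgebra ℂ L) (n : Submodule ℂ L)
    (lam : Module.Dual ℂ H) (v : V) : Prop where
  finiteDimensional : FiniteDimensional ℂ V
  irreducible : LieModule.IsIrreducible ℂ L V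
  weight : IsWeightVector H lam v
  raising : ∀ x ∈ n, ⁅x, v⁆ = 0

/-- The ordered product `∏ f i ^ m i` in the universal enveloping algebra, the factors being
taken in the sequence `s`. -/
def orderedMonomial {ι : Type*} (s : List ι) (f : ι → L) (m : ι →₀ ℕ) :
    UniversalEnvelopingAlgebra ℂ L :=
  (s.map fun i => UniversalEnvelopingAlgebra.ι ℂ (f i) ^ m i).prod

/-- The vector `m v`. -/
def monomialAct {ι : Type*} (s : List ι) (f : ι → L) (m : ι →₀ ℕ) (v : V) : V :=
  UniversalEnvelopingAlgebra.lift ℂ (LieModule.toEnd ℂ L V) (orderedMonomial s f m) v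

/-- The linear span of the vectors `m' v` with `m' < m`. -/
def lowerSpan {ι : Type*} (s : List ι) (f : ι → L) (mo : MonomialOrder ι) (v : V) (m : ι →₀ ℕ) :
    Submodule ℂ V :=
  Submodule.span ℂ {u | ∃ m' : ι →₀ ℕ, m' ≺[mo] m ∧ u = monomialAct s f m' v}

/-- The set of essential monomials of `V` with respect to the vector `v`. -/
def essential {ι : Type*} (s : List ι) (f : ι → L) (mo : MonomialOrder ι) (v : V) :
    Set (ι →₀ ℕ) :=
  {m | monomialAct s f m v ∉ lowerSpan s f mo v m}

/-- The set `ess(lam)` of essential monomials of the irreducible module of highest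
weight `lam` (empty if `lam` is not dominant). -/
def ess {ι : Type*} (s : List ι) (f : ι → L) (mo : MonomialOrder ι)
    (H : LieSubalgebra ℂ L) (n : Submodule ℂ L) (lam : Module.Dual ℂ H) : Set (ι →₀ ℕ) :=
  {m | ∃ (V : Type w) (_ : AddCommGroup V) (_ : Module ℂ V) (_ : LieRingModule L V)
      (_ : LieModule ℂ L V) (v : V),
      IsHighestWeightModule H n lam v ∧ m ∈ essential s f mo v}

end Modules

section Order

variable {ι₀ ι₁ : Type*}

/-- The branching order on monomials `m₀ m₁`: first compare the `m₁`, then the `m₀`. -/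
def branchingOrder (mo₀ : MonomialOrder ι₀) (mo₁ : MonomialOrder ι₁) :
    MonomialOrder (ι₀ ⊕ ι₁) where
  syn := mo₁.syn ×ₗ mo₀.syn
  toSyn :=
    { toFun := fun m => toLex
        (mo₁.toSyn (Finsupp.sumFinsuppAddEquivProdFinsupp m).2,
          mo₀.toSyn (Finsupp.sumFinsuppAddEquivProdFinsupp m).1)
      invFun := fun x => Finsupp.sumFinsuppAddEquivProdFinsupp.symm
        (mo₀.toSyn.symm (ofLex x).2, mo₁.toSyn.symm (ofLex x).1)
      left_inv := fun m => by simp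
      right_inv := fun x => by simp
      map_add' := fun a b => by
        rw [map_add, Prod.snd_add, Prod.fst_add, map_add, map_add]
        rfl }
  toSyn_monotone := fun a b h => by
    refine Prod.Lex.toLex_mono ⟨mo₁.toSyn_monotone fun i => ?_, mo₀.toSyn_monotone fun i => ?_⟩
    · exact h (Sum.inr i)
    · exact h (Sum.inl i)

theorem branchingOrder_lt_iff (mo₀ : MonomialOrder ι₀) (mo₁ : MonomialOrder ι₁)
    (a₀ b₀ : ι₀ →₀ ℕ) (a₁ b₁ : ι₁ →₀ ℕ) :
    (a₀.sumElim a₁ ≺[branchingOrder mo₀ mo₁] b₀.sumElim b₁) ↔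
      (a₁ ≺[mo₁] b₁) ∨ (a₁ = b₁ ∧ a₀ ≺[mo₀] b₀) := by
  have h (a₀ : ι₀ →₀ ℕ) (a₁ : ι₁ →₀ ℕ) :
      Finsupp.sumFinsuppAddEquivProdFinsupp (a₀.sumElim a₁) = (a₀, a₁) := by
    ext i <;> simp
  have e : (a₀.sumElim a₁ ≺[branchingOrder mo₀ mo₁] b₀.sumElim b₁) ↔
      (toLex (mo₁.toSyn a₁, mo₀.toSyn a₀) : mo₁.syn ×ₗ mo₀.syn) <
        toLex (mo₁.toSyn b₁, mo₀.toSyn b₀) := by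
    have h' (a₀ : ι₀ →₀ ℕ) (a₁ : ι₁ →₀ ℕ) :
        (branchingOrder mo₀ mo₁).toSyn (a₀.sumElim a₁) =
          (toLex (mo₁.toSyn a₁, mo₀.toSyn a₀) : mo₁.syn ×ₗ mo₀.syn) := by
      change toLex (mo₁.toSyn (Finsupp.sumFinsuppAddEquivProdFinsupp (a₀.sumElim a₁)).2,
        mo₀.toSyn (Finsupp.sumFinsuppAddEquivProdFinsupp (a₀.sumElim a₁)).1) = _
      rw [h]
    rw [h', h']
    exact Iff.rfl
  rw [e, Prod.Lex.toLex_lt_toLex]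
  simp

end Order

section Branching

variable {𝔤 : Type u} [LieRing 𝔤] [LieAlgebra ℂ 𝔤]
variable {k l : ℕ}

/-- The sequence of factors: first those from `𝔫₀⁻`, then those from `𝔯`. -/
def factorSeq (k l : ℕ) : List (Fin k ⊕ Fin l) :=
  (List.finRange k).map Sum.inl ++ (List.finRange l).map Sum.inr

/-- The root vectors of `𝔫₀⁻` and of `𝔯`, joined into one family. -/
def joinBasis {𝔤₀ : LieSubalgebra ℂ 𝔤} (f₀ : Fin k → 𝔤₀) (f₁ : Fin l → 𝔤) : Fin k ⊕ Fin l → 𝔤 :=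
  Sum.elim (fun i => (f₀ i : 𝔤)) f₁

/-- The monomial `m₀ m₁`. -/
def joinMonomial (m₀ : Fin k →₀ ℕ) (m₁ : Fin l →₀ ℕ) : Fin k ⊕ Fin l →₀ ℕ := m₀.sumElim m₁

/-- The restriction on the branching order: for every dominant weight, every monomial
`m₁ ≠ 1` in `𝔯` and every `x ∈ 𝔫₀⁺`, the vector `x m₁ v` lies in the span of the
`m v` with `m < m₁`. -/
def IsBranchingCompatible (H : LieSubalgebra ℂ 𝔤) (n : Submodule ℂ 𝔤) {𝔤₀ : LieSubalgebra ℂ 𝔤}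
    (f₀ : Fin k → 𝔤₀) (f₁ : Fin l → 𝔤)
    (mo₀ : MonomialOrder (Fin k)) (mo₁ : MonomialOrder (Fin l)) : Prop :=
  ∀ (V : Type w) [AddCommGroup V] [Module ℂ V] [LieRingModule 𝔤 V] [LieModule ℂ 𝔤 V]
    (lam : Module.Dual ℂ H) (v : V), IsHighestWeightModule H n lam v →
    ∀ m₁ : Fin l →₀ ℕ, m₁ ≠ 0 → ∀ x ∈ n, x ∈ 𝔤₀ →
      ⁅x, monomialAct (factorSeq k l) (joinBasis f₀ f₁) (joinMonomial 0 m₁) v⁆ ∈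
        lowerSpan (factorSeq k l) (joinBasis f₀ f₁) (branchingOrder mo₀ mo₁) v (joinMonomial 0 m₁)

/-- The branching semigroup of `𝔤 ↓ 𝔤₀`. -/
def branchingSemigroup (H : LieSubalgebra ℂ 𝔤) (n : Submodule ℂ 𝔤) {𝔤₀ : LieSubalgebra ℂ 𝔤}
    (f₀ : Fin k → 𝔤₀) (f₁ : Fin l → 𝔤)
    (mo₀ : MonomialOrder (Fin k)) (mo₁ : MonomialOrder (Fin l)) :
    Set (Module.Dual ℂ H × (Fin l →₀ ℕ)) :=
  {q | joinMonomial 0 q.2 ∈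
    ess.{u, w} (factorSeq k l) (joinBasis f₀ f₁) (branchingOrder mo₀ mo₁) H n q.1}

end Branching

end FFLVBranching

end

/-! Fix `m₁` and let `N` be the span of all `m₀' m₁' v` with `m₁' < m₁`. By the shape of the
branching order, the vectors below `m₀ m₁` span `N` plus the lower span of `m₀` applied to `m₁ v`.
Hence `m₀ m₁` is essential for `v` exactly when `m₀` is essential for the image of `m₁ v` in `V /
N`. The compatibility assumption makes each such `N` a `𝔤₀`-submodule
(`lie_mem_branchingFiltration`, by induction along the order): modulo `N`, the vector `m₁ v` is an
`𝔥₀`-eigenvector killed by `𝔫₀⁺`, so its ordered `𝔫₀⁻`-monomials span something `𝔤₀`-stable. If its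
image is zero, neither `m₁` nor any `m₀ m₁` is essential. Otherwise `m₁` is essential and the image
generates a finite-dimensional irreducible `𝔤₀`-module of highest weight `μ`, so that essentiality
of `m₀` becomes membership in `ess(μ)`. Three facts carry this. A highest weight vector of a
finite-dimensional module over a reductive algebra generates an irreducible module
(`IsTriangular.isIrreducible`); this rests on complete reducibility, obtained from Casimir elements
and Whitehead's lemma. The set `ess` does not depend on the chosen realisation of the irreducible
module (`IsTriangular.essential_eq`, by a diagonal argument). Finally, `𝔤₀` has its own triangular
decomposition, graded by an element of `𝔥₀` (`IsDefiningElement.exists_isTriangular`); here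
semisimplicity of the centre is used. -/

namespace LieModule

open LieAlgebra Module

attribute [local instance] LieRing.ofAssociativeRing

variable {K L : Type*} [Field K] [LieRing L] [LieAlgebra K L]

/-! ### Casimir tensors and Cartan's criterion for trace forms. -/

section Casimir

variable {M : Type*} [AddCommGroup M] [Module K M] [LieRingModule L M] [LieModule K L M]

/-- The Casimir tensor of a pair of bases of an ideal, dual for a trace form, is invariant. -/
theorem sum_lie_dualBasis_add {W ι : Type*} [AddCommGroup W] [Module K W] [Fintype ι]
    [DecidableEq ι] [FiniteDimensional K L] (I : LieIdeal K L)
    (hB : (traceForm K I M).Nondegenerate) (b : Basis ι K I) (β : I →ₗ[K] I →ₗ[K] W) (x : L) :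
    ∑ i, (β ⁅x, b i⁆ ((traceForm K I M).dualBasis hB b i) +
      β (b i) ⁅x, (traceForm K I M).dualBasis hB b i⁆) = 0 := by
  set B := traceForm K I M with hBdef
  have hS : B.IsSymm := ⟨traceForm_comm K I M⟩
  set b' := B.dualBasis hB b with hb'
  have hinv (y z : I) : B ⁅x, y⁆ z = - B y ⁅x, z⁆ := by
    have := traceForm_apply_lie_apply' K L M x (y : L) (z : L)
    exact this
  have h1 (y : I) : y = ∑ j, B y (b' j) • b j := by
    conv_lhs => rw [← b.sum_repr y]
    refine Finset.sum_congr rfl fun j _ => ?_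
    congr 1
    have := B.dualBasis_repr_apply hB b' y j
    rwa [hb', LinearMap.BilinForm.dualBasis_dualBasis hB hS] at this
  have h2 (z : I) : z = ∑ j, B z (b j) • b' j := by
    conv_lhs => rw [← b'.sum_repr z]
    refine Finset.sum_congr rfl fun j _ => ?_
    rw [hb', B.dualBasis_repr_apply hB b z j]
  have e1 (i : ι) : β ⁅x, b i⁆ (b' i) = ∑ j, B ⁅x, b i⁆ (b' j) • β (b j) (b' i) := by
    conv_lhs => rw [h1 ⁅x, b i⁆]
    simp
  have e2 (i : ι) : β (b i) ⁅x, b' i⁆ = ∑ j, B ⁅x, b' i⁆ (b j) • β (b i) (b' j) := by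
    conv_lhs => rw [h2 ⁅x, b' i⁆]
    simp
  rw [Finset.sum_add_distrib, Finset.sum_congr rfl fun i _ => e1 i,
    Finset.sum_congr rfl fun i _ => e2 i, Finset.sum_comm (f := fun i j => _ • β (b i) (b' j)),
    ← Finset.sum_add_distrib]
  refine Finset.sum_eq_zero fun i _ => ?_
  rw [← Finset.sum_add_distrib]
  refine Finset.sum_eq_zero fun j _ => ?_
  rw [hinv, hS.eq, neg_smul, neg_add_cancel]

/-- Engel's theorem: each element acts nilpotently on `M`, hence ad-nilpotently on endomorphisms,
and faithfulness carries this back to `L`. -/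
theorem isNilpotent_of_isNilpotent_of_injective [FiniteDimensional K L] [IsNilpotent L M]
    (h : Function.Injective (toEnd K L M)) : LieRing.IsNilpotent L := by
  rw [LieAlgebra.isNilpotent_iff_forall (R := K)]
  intro x
  obtain ⟨n, hn⟩ := LieAlgebra.ad_nilpotent_of_nilpotent (R := K)
    (isNilpotent_toEnd_of_isNilpotent K L M x)
  refine ⟨n, LinearMap.ext fun y => h ?_⟩
  have key (k : ℕ) : toEnd K L M ((ad K L x ^ k) y) =
      (ad K (Module.End K M) (toEnd K L M x) ^ k) (toEnd K L M y) := by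
    induction k with
    | zero => rfl
    | succ k ih =>
      rw [pow_succ', pow_succ', Module.End.mul_apply, Module.End.mul_apply, ← ih, ad_apply,
        LieHom.map_lie, ad_apply]
  rw [key, hn]
  simp

/-- An ideal of a semisimple Lie algebra acting faithfully has a nondegenerate trace form. -/
theorem traceForm_nondegenerate_of_disjoint_ker [CharZero K] [FiniteDimensional K L]
    [FiniteDimensional K M] [HasTrivialRadical K L] (I : LieIdeal K L)
    (hI : ∀ x ∈ I, toEnd K L M x = 0 → x = 0) :
    (traceForm K I M).Nondegenerate := by
  -- The radical of the form inside `I`. Its own trace form vanishes, so its derived algebra acts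
  -- nilpotently and faithfully; thus it is solvable, hence zero.
  let J : LieIdeal K L :=
    { carrier := {x | x ∈ I ∧ ∀ y ∈ I, traceForm K L M x y = 0}
      add_mem' := fun ha hb => ⟨I.add_mem ha.1 hb.1, fun y hy => by
        rw [map_add, LinearMap.add_apply, ha.2 y hy, hb.2 y hy, add_zero]⟩
      zero_mem' := ⟨I.zero_mem, fun y _ => by simp⟩
      smul_mem' := fun c x hx => ⟨I.smul_mem c hx.1, fun y hy => by
        rw [map_smul, LinearMap.smul_apply, hx.2 y hy, smul_zero]⟩
      lie_mem := fun {x m} hm => ⟨lie_mem_right K L I x m hm.1, fun y hy => by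
        rw [traceForm_apply_lie_apply', hm.2 _ (lie_mem_right K L I x y hy), neg_zero]⟩ }
  have hJ : traceForm K J M = 0 := by
    ext x y
    exact x.2.2 y y.2.1
  have hnil := isNilpotent_derivedSeries_of_traceForm_eq_zero hJ
  have hD : LieRing.IsNilpotent (derivedSeries K J 1) := by
    refine isNilpotent_of_isNilpotent_of_injective (K := K) (M := M) ?_
    rw [injective_iff_map_eq_zero]
    intro x hx
    have : ((x : J) : L) = 0 := hI _ (x : J).2.1 hx
    exact Subtype.ext (Subtype.ext this)
  have hJs : IsSolvable J := by
    obtain ⟨k, hk⟩ := IsSolvable.solvable K (derivedSeries K J 1)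
    rw [LieIdeal.derivedSeries_eq_bot_iff] at hk
    refine IsSolvable.mk (k := k + 1) (R := K) ?_
    rw [derivedSeries_def, derivedSeriesOfIdeal_add]
    exact hk
  have hJb : J = ⊥ := HasTrivialRadical.eq_bot_of_isSolvable J
  have hl : (traceForm K I M).SeparatingLeft := by
    intro x hx
    have : (x : L) ∈ J := ⟨x.2, fun y hy => hx ⟨y, hy⟩⟩
    rw [hJb, LieSubmodule.mem_bot] at this
    exact Subtype.ext this
  exact ⟨hl, fun x hx => hl x fun y => by rw [traceForm_comm]; exact hx y⟩

end Casimir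

/-! ### Whitehead's first lemma and Weyl's theorem. -/

/-- A finite-dimensional semisimple Lie algebra is perfect. -/
theorem span_lie_eq_top_of_hasTrivialRadical [CharZero K] [FiniteDimensional K L]
    [HasTrivialRadical K L] : ⁅(⊤ : LieIdeal K L), (⊤ : LieIdeal K L)⁆ = ⊤ := by
  set D := ⁅(⊤ : LieIdeal K L), (⊤ : LieIdeal K L)⁆
  have hc := D.isCompl_killingCompl
  have : IsLieAbelian D.killingCompl := by
    rw [LieSubmodule.lie_abelian_iff_lie_self_eq_bot, eq_bot_iff, ← hc.inf_eq_bot]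
    exact le_inf (LieSubmodule.mono_lie le_top le_top) (LieSubmodule.lie_le_right _ _)
  have hb : D.killingCompl = ⊥ := IsKilling.ideal_eq_bot_of_isLieAbelian _
  simpa [hb] using hc.sup_eq_top

/-- **Whitehead's first lemma**. -/
theorem exists_forall_eq_lie_of_cocycle [CharZero K] [FiniteDimensional K L]
    [HasTrivialRadical K L] {M : Type*} [AddCommGroup M] [Module K M] [LieRingModule L M]
    [LieModule K L M] [FiniteDimensional K M] (φ : L →ₗ[K] M)
    (hφ : ∀ x y, φ ⁅x, y⁆ = ⁅x, φ y⁆ - ⁅y, φ x⁆) : ∃ m : M, ∀ x, φ x = ⁅x, m⁆ := by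
  classical
  induction hn : finrank K M using Nat.strong_induction_on generalizing M with
  | _ n ih =>
  by_cases htriv : LieModule.ker K L M = ⊤
  · have h0 (x : L) (m : M) : ⁅x, m⁆ = 0 := by
      have : x ∈ LieModule.ker K L M := by rw [htriv]; trivial
      rw [LieModule.mem_ker] at this
      exact this m
    refine ⟨0, fun x => ?_⟩
    have hx : x ∈ ⁅(⊤ : LieIdeal K L), (⊤ : LieIdeal K L)⁆ := by
      rw [span_lie_eq_top_of_hasTrivialRadical]; trivial
    rw [← LieSubmodule.mem_toSubmodule, LieSubmodule.lieIdeal_oper_eq_linear_span'] at hx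
    have : (⁅x, (0 : M)⁆ : M) = 0 := lie_zero x
    rw [this, ← LinearMap.mem_ker]
    refine Submodule.span_le.mpr ?_ hx
    rintro _ ⟨a, -, b, -, rfl⟩
    simp [hφ, h0]
  -- The ideal complementary to the kernel acts faithfully, so its trace form on `M` has dual bases.
  -- The resulting Casimir operator `c` commutes with `L` and has trace `dim I ≠ 0`.
  set I := (LieModule.ker K L M).killingCompl
  have hc := (LieModule.ker K L M).isCompl_killingCompl
  have hI : ∀ x ∈ I, toEnd K L M x = 0 → x = 0 := by
    intro x hx h0
    have : x ∈ LieModule.ker K L M ⊓ I := ⟨h0, hx⟩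
    rwa [hc.inf_eq_bot, LieSubmodule.mem_bot] at this
  have hI0 : I ≠ ⊥ := fun h => htriv <| by
    simpa [show (LieModule.ker K L M).killingCompl = ⊥ from h] using hc.sup_eq_top
  have hB := traceForm_nondegenerate_of_disjoint_ker (M := M) I hI
  let b := Module.finBasis K I
  let b' := (traceForm K I M).dualBasis hB b
  let ρ := toEnd K I M
  let c : Module.End K M := ∑ i, ρ (b i) * ρ (b' i)
  have hcomm (x : L) (m : M) : c ⁅x, m⁆ = ⁅x, c m⁆ := by
    have := sum_lie_dualBasis_add (M := M) I hB b
      ((LinearMap.mul K (Module.End K M)).compl₁₂ ρ.toLinearMap ρ.toLinearMap) x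
    have := congrArg (fun f : Module.End K M => f m) this
    simp only [LinearMap.compl₁₂_apply, LinearMap.sum_apply, LinearMap.zero_apply] at this
    simp only [c, LinearMap.sum_apply, lie_sum]
    rw [eq_comm, ← sub_eq_zero, ← Finset.sum_sub_distrib, ← this]
    refine Finset.sum_congr rfl fun i _ => ?_
    have e1 (y : I) (m : M) : ρ ⁅x, y⁆ m = ⁅x, ρ y m⁆ - ρ y ⁅x, m⁆ := by
      change ⁅⁅x, (y : L)⁆, m⁆ = ⁅x, ⁅(y : L), m⁆⁆ - ⁅(y : L), ⁅x, m⁆⁆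
      rw [lie_lie]
    change _ = ρ ⁅x, b i⁆ (ρ (b' i) m) + ρ (b i) (ρ ⁅x, b' i⁆ m)
    rw [e1, e1, map_sub]
    simp
  have hnn : ¬ _root_.IsNilpotent c := by
    intro h
    have h1 := (LinearMap.isNilpotent_trace_of_isNilpotent h).eq_zero
    have h2 : LinearMap.trace K M c = (finrank K I : K) := by
      have (i : Fin _) : LinearMap.trace K M (ρ (b i) * ρ (b' i)) = 1 := by
        have := LinearMap.BilinForm.apply_dualBasis_right hB ⟨traceForm_comm K I M⟩ b i i
        rw [if_pos rfl] at this
        exact this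
      simp [c, this]
    rw [h2, Nat.cast_eq_zero] at h1
    exact hI0 (by simpa using Submodule.finrank_eq_zero.mp h1)
  -- The Casimir contraction of the cocycle shows that `c ∘ φ` is a coboundary.
  let m := ∑ i, ⁅(b i : L), φ (b' i)⁆
  have hm (x : L) : ⁅x, m⁆ = c (φ x) := by
    have := sum_lie_dualBasis_add (M := M) I hB b
      (LinearMap.mk₂ K (fun y z : I => ⁅(y : L), φ z⁆) (by simp) (by simp) (by simp) (by simp)) x
    simp only [m, c, LinearMap.sum_apply, lie_sum]
    rw [← sub_eq_zero, ← Finset.sum_sub_distrib, ← this]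
    refine Finset.sum_congr rfl fun i _ => ?_
    change _ = ⁅⁅x, (b i : L)⁆, φ (b' i)⁆ + ⁅(b i : L), φ ⁅x, (b' i : L)⁆⁆
    change _ - ⁅(b i : L), ⁅(b' i : L), φ x⁆⁆ = _
    rw [hφ, lie_lie, lie_sub]
    abel
  have hcommN (N : ℕ) (x : L) (m : M) : (c ^ N) ⁅x, m⁆ = ⁅x, (c ^ N) m⁆ := by
    induction N with
    | zero => rfl
    | succ N ih => rw [pow_succ', Module.End.mul_apply, ih, hcomm, Module.End.mul_apply]
  -- Fitting decomposition of `c`: on the stable image `c` is invertible, so `φ` can be corrected by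
  -- a coboundary to take values in the kernel of a power of `c`. That kernel is a proper submodule
  -- because `c` is not nilpotent, and induction applies.
  obtain ⟨N, hN⟩ := Filter.eventually_atTop.mp c.eventually_isCompl_ker_pow_range_pow
  obtain ⟨m', hm'⟩ : ∃ m', ∀ x, (c ^ (N + 1)) (φ x - ⁅x, m'⁆) = 0 := by
    have hNN := hN (N + 1) (by omega)
    have hr : (c ^ N) m ∈ LinearMap.range (c ^ (N + 1)) ⊔ LinearMap.ker (c ^ (N + 1)) := by
      rw [sup_comm, hNN.sup_eq_top]; trivial
    obtain ⟨_, ⟨m', rfl⟩, k, hk, hmk⟩ := Submodule.mem_sup.mp hr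
    refine ⟨m', fun x => ?_⟩
    have h1 : (c ^ (N + 1)) (φ x - ⁅x, m'⁆) = ⁅x, k⁆ := by
      rw [map_sub, hcommN, pow_succ, Module.End.mul_apply, ← hm, hcommN, ← lie_sub, ← hmk,
        pow_succ]
      simp
    have h2 : ⁅x, k⁆ ∈ LinearMap.ker (c ^ (N + 1)) := by
      rw [LinearMap.mem_ker, hcommN, LinearMap.mem_ker.mp hk, lie_zero]
    have : ⁅x, k⁆ ∈ LinearMap.ker (c ^ (N + 1)) ⊓ LinearMap.range (c ^ (N + 1)) :=
      ⟨h2, _, h1⟩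
    rw [hNN.inf_eq_bot, Submodule.mem_bot] at this
    rw [h1, this]
  let N' : LieSubmodule K L M :=
    { LinearMap.ker (c ^ (N + 1)) with
      lie_mem := fun {x m} hm => by
        change (c ^ (N + 1)) m = 0 at hm
        change (c ^ (N + 1)) _ = 0
        rw [hcommN, hm, lie_zero] }
  have hlt : finrank K N' < n := by
    rw [← hn]
    refine Submodule.finrank_lt (s := LinearMap.ker (c ^ (N + 1))) ?_
    intro h
    exact hnn ⟨N + 1, LinearMap.ker_eq_top.mp h⟩
  let φ' : L →ₗ[K] N' :=
    { toFun := fun x => ⟨φ x - ⁅x, m'⁆, hm' x⟩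
      map_add' := fun x y => Subtype.ext (by
        simp only [map_add, add_lie]
        exact add_sub_add_comm _ _ _ _)
      map_smul' := fun a x => Subtype.ext (by simp [smul_sub]) }
  obtain ⟨u, hu⟩ := ih _ hlt φ' (fun x y => Subtype.ext (by
    change φ ⁅x, y⁆ - ⁅⁅x, y⁆, m'⁆ = ⁅x, φ y - ⁅y, m'⁆⁆ - ⁅y, φ x - ⁅x, m'⁆⁆
    rw [hφ, lie_lie, lie_sub, lie_sub]
    abel)) rfl
  refine ⟨u + m', fun x => ?_⟩
  have : φ x - ⁅x, m'⁆ = ⁅x, (u : M)⁆ := congrArg Subtype.val (hu x)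
  rw [lie_add, ← this, sub_add_cancel]

/-- **Weyl's theorem** on complete reducibility. -/
theorem exists_isCompl_of_hasTrivialRadical [CharZero K] [FiniteDimensional K L]
    [HasTrivialRadical K L] {M : Type*} [AddCommGroup M] [Module K M] [LieRingModule L M]
    [LieModule K L M] [FiniteDimensional K M] (N : LieSubmodule K L M) :
    ∃ N' : LieSubmodule K L M, IsCompl N N' := by
  obtain ⟨p, hp⟩ : ∃ p : M →ₗ[K] N, p ∘ₗ N.toSubmodule.subtype = LinearMap.id :=
    N.toSubmodule.subtype.exists_leftInverse_of_injective
      (LinearMap.ker_eq_bot.mpr Subtype.val_injective)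
  replace hp (y : N) : p y = y := LinearMap.congr_fun hp y
  -- Brackets with a linear projection `p` onto `N` vanish on `N`, so they form a cocycle in this
  -- module. Writing it as the coboundary of `q` makes `p - q` an equivariant projection.
  let A : LieSubmodule K L (M →ₗ[K] N) :=
    { carrier := {f | ∀ y : N, f y = 0}
      add_mem' := fun ha hb y => by simp [ha y, hb y]
      zero_mem' := fun y => rfl
      smul_mem' := fun c f hf y => by simp [hf y]
      lie_mem := fun {x f} hf y => by
        change ⁅x, f y⁆ - f ⁅x, (y : M)⁆ = 0
        have : f ⁅x, (y : M)⁆ = 0 := hf ⁅x, y⁆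
        rw [hf y, this, lie_zero, sub_zero] }
  have hA (x : L) : ⁅x, p⁆ ∈ A := fun y => by
    change ⁅x, p y⁆ - p ⁅x, (y : M)⁆ = 0
    have : p ⁅x, (y : M)⁆ = ⁅x, y⁆ := hp ⁅x, y⁆
    rw [hp, this, sub_self]
  let φ : L →ₗ[K] A :=
    { toFun := fun x => ⟨⁅x, p⁆, hA x⟩
      map_add' := fun x y => Subtype.ext (add_lie _ _ _)
      map_smul' := fun a x => Subtype.ext (smul_lie _ _ _) }
  obtain ⟨q, hq⟩ := exists_forall_eq_lie_of_cocycle φ fun x y => Subtype.ext (lie_lie x y _)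
  have hq' (x : L) (m : M) : ⁅x, p m⁆ - p ⁅x, m⁆ = ⁅x, (q : M →ₗ[K] N) m⁆ -
      (q : M →ₗ[K] N) ⁅x, m⁆ := LinearMap.congr_fun (congrArg Subtype.val (hq x)) m
  let π : M →ₗ[K] N := p - q
  have hπ (y : N) : π y = y := by
    change p y - (q : M →ₗ[K] N) y = y
    rw [hp, q.2 y, sub_zero]
  have hπx (x : L) (m : M) : π ⁅x, m⁆ = ⁅x, π m⁆ := by
    change p _ - (q : M →ₗ[K] N) _ = ⁅x, p m - (q : M →ₗ[K] N) m⁆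
    have := hq' x m
    rw [lie_sub]
    rw [sub_eq_sub_iff_add_eq_add] at this ⊢
    rw [add_comm, ← this, add_comm]
  refine ⟨{ LinearMap.ker π with
    lie_mem := fun {x m} hm => by
      change π m = 0 at hm
      change π _ = 0
      rw [hπx, hm, lie_zero] }, ?_⟩
  rw [← LieSubmodule.isCompl_toSubmodule]
  exact LinearMap.isCompl_of_proj hπ

end LieModule

/-! ### Structure of reductive Lie algebras. -/

namespace LieAlgebra

open LieModule Module

variable {K L : Type*} [Field K] [LieRing L] [LieAlgebra K L] [FiniteDimensional K L]

attribute [local instance] LieRing.ofAssociativeRing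

/-- The adjoint algebra of a reductive Lie algebra is semisimple. -/
theorem hasTrivialRadical_range_ad [HasCentralRadical K L] :
    HasTrivialRadical K (ad K L).range := by
  refine hasTrivialRadical_of_no_solvable_ideals fun J hJ => ?_
  let f := (ad K L).rangeRestrict
  have hf : Function.Surjective f := (ad K L).surjective_rangeRestrict
  let I : LieIdeal K L := J.comap f
  have hD (k : ℕ) (x : L) (hx : x ∈ derivedSeriesOfIdeal K L k I) :
      f x ∈ derivedSeriesOfIdeal K (ad K L).range k J := by
    have : (derivedSeriesOfIdeal K L k I).map f ≤ derivedSeriesOfIdeal K _ k J := by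
      clear hx
      induction k with
      | zero => exact LieIdeal.map_comap_le
      | succ k ih =>
        rw [derivedSeriesOfIdeal_succ, derivedSeriesOfIdeal_succ]
        exact (LieIdeal.map_bracket_le f).trans (LieSubmodule.mono_lie ih ih)
    exact this (LieIdeal.mem_map hx)
  obtain ⟨k, hk⟩ := IsSolvable.solvable K J
  rw [LieIdeal.derivedSeries_eq_bot_iff] at hk
  -- The kernel of `ad` is the centre, so the preimage of a solvable ideal is solvable; by
  -- reductivity it is then central, and its image is zero.
  have hz : derivedSeriesOfIdeal K L k I ≤ center K L := by
    intro x hx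
    have := hD k x hx
    rw [hk, LieSubmodule.mem_bot] at this
    have h0 : ad K L x = 0 := congrArg Subtype.val this
    rw [← self_module_ker_eq_center]
    exact h0
  have hI : IsSolvable I := by
    refine IsSolvable.mk (R := K) (k := 1 + k) ?_
    rw [LieIdeal.derivedSeries_eq_bot_iff, derivedSeriesOfIdeal_add,
      ← LieAlgebra.abelian_iff_derived_one_eq_bot]
    exact abelian_of_le_center K L _ hz
  have hIc : I ≤ center K L := by
    rw [← HasCentralRadical.radical_eq_center]
    exact (LieIdeal.solvable_iff_le_radical K L I).mp hI
  rw [LieSubmodule.eq_bot_iff]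
  intro y hy
  obtain ⟨x, rfl⟩ := hf y
  have hx : x ∈ center K L := hIc hy
  rw [← self_module_ker_eq_center] at hx
  exact Subtype.ext hx

variable [CharZero K]

/-- A reductive Lie algebra is the direct sum of its centre and a semisimple ideal. -/
theorem exists_isCompl_center [HasCentralRadical K L] :
    ∃ S : LieIdeal K L, IsCompl S (center K L) ∧ HasTrivialRadical K S := by
  have := hasTrivialRadical_range_ad (K := K) (L := L)
  -- `L` is a module over its semisimple adjoint algebra, so Weyl's theorem supplies a complementary
  -- ideal to the centre.
  let Z : LieSubmodule K (ad K L).range L :=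
    { center K L with
      lie_mem := fun {x m} hm => by
        obtain ⟨_, y, rfl⟩ := x
        exact (center K L).lie_mem (x := y) hm }
  obtain ⟨N, hN⟩ := exists_isCompl_of_hasTrivialRadical Z
  let S : LieIdeal K L :=
    { N with
      lie_mem := fun {x m} hm => N.lie_mem (x := ⟨ad K L x, x, rfl⟩) hm }
  have hS : IsCompl S (center K L) := by
    rw [← LieSubmodule.isCompl_toSubmodule] at hN ⊢
    exact hN.symm
  refine ⟨S, hS, hasTrivialRadical_of_no_solvable_ideals fun J hJ => ?_⟩
  -- Since the centre brackets trivially with `S`, an ideal of `S` is an ideal of `L`. If solvable,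
  -- it is central, and so meets `S` in zero.
  let J' : LieIdeal K L :=
    { J.toSubmodule.map S.toSubmodule.subtype with
      lie_mem := fun {x m} hm => by
        obtain ⟨j, hj, rfl⟩ := hm
        have hx : x ∈ S ⊔ center K L := by rw [hS.sup_eq_top]; trivial
        obtain ⟨s, hs, z, hz, rfl⟩ := (LieSubmodule.mem_sup _ _ _).mp hx
        refine ⟨⁅(⟨s, hs⟩ : S), j⁆, J.lie_mem hj, ?_⟩
        have hzj : ⁅z, (j : L)⁆ = 0 := by rw [← lie_skew, hz, neg_zero]
        change ⁅s, (j : L)⁆ = ⁅s + z, (j : L)⁆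
        rw [add_lie, hzj, add_zero] }
  have hJ'S (x : L) (hx : x ∈ J') : x ∈ S := by
    obtain ⟨j, -, rfl⟩ := hx
    exact j.2
  have hJ'J (x : L) (hx : x ∈ J') : (⟨x, hJ'S x hx⟩ : S) ∈ J := by
    obtain ⟨j, hj, rfl⟩ := hx
    exact hj
  let g : J' →ₗ⁅K⁆ J :=
    { toFun := fun x => ⟨⟨x, hJ'S x x.2⟩, hJ'J x x.2⟩
      map_add' := fun _ _ => rfl
      map_smul' := fun _ _ => rfl
      map_lie' := rfl }
  have hg : Function.Injective g := fun x y h =>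
    Subtype.ext (congrArg (fun z : J => ((z : S) : L)) h)
  have : IsSolvable J' := hg.lieAlgebra_isSolvable
  have hc : J' ≤ center K L := by
    rw [← HasCentralRadical.radical_eq_center]
    exact (LieIdeal.solvable_iff_le_radical K L J').mp this
  rw [LieSubmodule.eq_bot_iff]
  intro j hj
  have hj' : (j : L) ∈ S ⊓ center K L := ⟨j.2, hc ⟨j, hj, rfl⟩⟩
  rw [hS.inf_eq_bot, LieSubmodule.mem_bot] at hj'
  exact Subtype.ext hj'

/-- Complete reducibility over a reductive Lie algebra whose centre acts by scalars. -/
theorem exists_isCompl_of_hasCentralRadical [HasCentralRadical K L] {M : Type*} [AddCommGroup M]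
    [Module K M] [LieRingModule L M] [LieModule K L M] [FiniteDimensional K M]
    (hz : ∀ z ∈ center K L, ∃ c : K, ∀ m : M, ⁅z, m⁆ = c • m) (N : LieSubmodule K L M) :
    ∃ N' : LieSubmodule K L M, IsCompl N N' := by
  obtain ⟨S, hS, _⟩ := exists_isCompl_center (K := K) (L := L)
  let NS : LieSubmodule K S M :=
    { N with lie_mem := fun {x m} hm => N.lie_mem (x := (x : L)) hm }
  obtain ⟨N', hN'⟩ := exists_isCompl_of_hasTrivialRadical NS
  refine ⟨{ N' with lie_mem := fun {x m} hm => ?_ }, ?_⟩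
  · have hx : x ∈ S ⊔ center K L := by rw [hS.sup_eq_top]; trivial
    obtain ⟨s, hs, z, hz', rfl⟩ := (LieSubmodule.mem_sup _ _ _).mp hx
    obtain ⟨c, hc⟩ := hz z hz'
    rw [add_lie, hc]
    exact N'.add_mem (N'.lie_mem (x := (⟨s, hs⟩ : S)) hm) (N'.smul_mem c hm)
  · rw [← LieSubmodule.isCompl_toSubmodule] at hN' ⊢
    exact hN'

/-- A derivation of a reductive Lie algebra that vanishes on the centre is inner. -/
theorem exists_eq_lie_of_derivation [HasCentralRadical K L] (D : L →ₗ[K] L)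
    (hD : ∀ x y, D ⁅x, y⁆ = ⁅D x, y⁆ + ⁅x, D y⁆) (hDz : ∀ z ∈ center K L, D z = 0) :
    ∃ t : L, ∀ x, D x = ⁅t, x⁆ := by
  obtain ⟨S, hS, _⟩ := exists_isCompl_center (K := K) (L := L)
  -- By the Leibniz rule, since `S` is an ideal equal to its derived algebra.
  have hDS (s : L) (hs : s ∈ S) : D s ∈ S := by
    have h1 : (⟨s, hs⟩ : S) ∈ ⁅(⊤ : LieIdeal K S), (⊤ : LieIdeal K S)⁆ := by
      rw [span_lie_eq_top_of_hasTrivialRadical]; trivial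
    rw [← LieSubmodule.mem_toSubmodule, LieSubmodule.lieIdeal_oper_eq_linear_span'] at h1
    change (⟨s, hs⟩ : S) ∈ (S.toSubmodule.comap D).comap S.toSubmodule.subtype
    refine Submodule.span_le.mpr ?_ h1
    rintro _ ⟨a, -, b, -, rfl⟩
    change D ⁅(a : L), (b : L)⁆ ∈ S
    rw [hD]
    exact S.add_mem (lie_mem_right K L S _ _ b.2) (lie_mem_left K L S _ _ a.2)
  let d : LieDerivation K S S :=
    { toFun := fun s => ⟨D s, hDS s s.2⟩
      map_add' := fun x y => Subtype.ext (map_add D _ _)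
      map_smul' := fun c x => Subtype.ext (map_smul D c _)
      leibniz' := fun x y => Subtype.ext (by
        change D ⁅(x : L), (y : L)⁆ = ⁅(x : L), D y⁆ - ⁅(y : L), D x⁆
        rw [hD, ← lie_skew (D x)]
        abel) }
  obtain ⟨t, ht⟩ := LieDerivation.IsKilling.exists_eq_ad d
  refine ⟨t, fun x => ?_⟩
  have hx : x ∈ S ⊔ center K L := by rw [hS.sup_eq_top]; trivial
  obtain ⟨s, hs, z, hz, rfl⟩ := (LieSubmodule.mem_sup _ _ _).mp hx
  have h1 : D s = ⁅(t : L), s⁆ := by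
    have := congrArg (fun e : LieDerivation K S S => ((e ⟨s, hs⟩ : S) : L)) ht
    rw [LieDerivation.ad_apply_apply] at this
    exact this.symm
  rw [map_add, h1, hDz z hz, lie_add, hz t]

end LieAlgebra

/-! ### Reordering products whose commutators are linear in the generators. -/

section Straightening

variable {K A ι : Type*} [Field K] [Ring A] [Algebra K A]

/-- The span of the products of at most `d` elements of a family. -/
def prodSpan (K : Type*) {A ι : Type*} [Field K] [Ring A] [Algebra K A] (x : ι → A) (d : ℕ) :
    Submodule K A :=
  Submodule.span K {a | ∃ l : List ι, l.length ≤ d ∧ a = (l.map x).prod}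

theorem mul_mem_prodSpan {x : ι → A} {d : ℕ} {c a : A} (hc : c ∈ Submodule.span K (Set.range x))
    (ha : a ∈ prodSpan K x d) : c * a ∈ prodSpan K x (d + 1) := by
  suffices ∀ i, ∀ a ∈ prodSpan K x d, x i * a ∈ prodSpan K x (d + 1) by
    have h : Submodule.span K (Set.range x) ≤
        (prodSpan K x (d + 1)).comap (LinearMap.mulRight K a) := by
      rw [Submodule.span_le]
      rintro _ ⟨i, rfl⟩
      exact this i a ha
    exact h hc
  intro i a ha
  have h : prodSpan K x d ≤ (prodSpan K x (d + 1)).comap (LinearMap.mulLeft K (x i)) := by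
    unfold prodSpan
    rw [Submodule.span_le]
    rintro _ ⟨l, hl, rfl⟩
    exact Submodule.subset_span ⟨i :: l, by simpa using hl, by simp⟩
  exact h ha

/-- An adjacent swap costs a commutator, which lies in the span of the generators and so shortens
the word by one. -/
theorem prod_map_sub_prod_map_mem_of_perm {x : ι → A}
    (hx : ∀ i j, x i * x j - x j * x i ∈ Submodule.span K (Set.range x)) {l l' : List ι}
    (h : l.Perm l') : (l.map x).prod - (l'.map x).prod ∈ prodSpan K x (l.length - 1) := by
  induction h with
  | nil => simp
  | @cons a l₁ l₂ h ih =>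
    -- The length bound uses truncated subtraction, so the empty tail is handled separately.
    rcases Nat.eq_zero_or_pos l₁.length with h0 | h0
    · have h1 := List.eq_nil_of_length_eq_zero h0
      subst h1
      rw [h.nil_eq, sub_self]
      exact zero_mem _
    · have := mul_mem_prodSpan (Submodule.subset_span ⟨a, rfl⟩) ih
      rw [Nat.sub_add_cancel h0] at this
      simpa [mul_sub] using this
  | swap a b l =>
    have := mul_mem_prodSpan (hx b a)
      (Submodule.subset_span ⟨l, le_rfl, rfl⟩ : (l.map x).prod ∈ prodSpan K x l.length)
    simpa [sub_mul, mul_assoc] using this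
  | trans h₁ h₂ ih₁ ih₂ =>
    rw [← h₁.length_eq] at ih₂
    simpa using add_mem ih₁ ih₂

theorem List.prod_map_flatMap_replicate {A : Type*} [Monoid A] (x : ι → A) (n : ι → ℕ)
    (s : List ι) :
    ((s.flatMap fun i => List.replicate (n i) i).map x).prod = (s.map fun i => x i ^ n i).prod := by
  induction s with
  | nil => simp
  | cons a s ih => simpa using congrArg (x a ^ n a * ·) ih

theorem List.perm_flatMap_replicate_count [DecidableEq ι] {s : List ι} (hs : s.Nodup)
    (hs' : ∀ i, i ∈ s) (l : List ι) : l.Perm (s.flatMap fun i => List.replicate (l.count i) i) := by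
  rw [List.perm_iff_count]
  intro a
  rw [List.count_flatMap]
  have h := List.sum_toFinset (fun i => List.count a (List.replicate (l.count i) i)) hs
  change _ = (s.map (fun i => List.count a (List.replicate (l.count i) i))).sum
  rw [← h, Finset.sum_eq_single a]
  · simp
  · intro b _ hb
    simp [List.count_replicate, hb]
  · intro ha
    exact absurd (List.mem_toFinset.mpr (hs' a)) ha

/-- The spanning half of the Poincaré–Birkhoff–Witt theorem. -/
theorem prod_map_mem_span_ordered {x : ι → A}
    (hx : ∀ i j, x i * x j - x j * x i ∈ Submodule.span K (Set.range x)) {s : List ι}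
    (hs : s.Nodup) (hs' : ∀ i, i ∈ s) (l : List ι) :
    (l.map x).prod ∈
      Submodule.span K (Set.range fun m : ι →₀ ℕ => (s.map fun i => x i ^ m i).prod) := by
  classical
  induction hd : l.length using Nat.strong_induction_on generalizing l with
  | _ d ih =>
  set l' := s.flatMap fun i => List.replicate (l.count i) i with hl'
  have hp : l.Perm l' := List.perm_flatMap_replicate_count hs hs' l
  have h1 := prod_map_sub_prod_map_mem_of_perm (K := K) hx hp
  have h2 : (l'.map x).prod =
      (s.map fun i => x i ^ (Multiset.toFinsupp (l : Multiset ι)) i).prod := by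
    rw [hl', List.prod_map_flatMap_replicate]
    simp
  rcases Nat.eq_zero_or_pos l.length with h0 | h0
  · rw [List.eq_nil_of_length_eq_zero h0]
    exact Submodule.subset_span ⟨0, by simp⟩
  have h3 : prodSpan K x (l.length - 1) ≤
      Submodule.span K (Set.range fun m : ι →₀ ℕ => (s.map fun i => x i ^ m i).prod) := by
    unfold prodSpan
    rw [Submodule.span_le]
    rintro _ ⟨l₁, hl₁, rfl⟩
    exact ih _ (by omega) l₁ rfl
  have h4 := add_mem (h3 h1) (Submodule.subset_span ⟨_, h2.symm⟩)
  rwa [sub_add_cancel] at h4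

end Straightening

/-! ### Ordered monomials and essential monomials in Lie modules. -/

namespace FFLVBranching

variable {L : Type u} [LieRing L] [LieAlgebra ℂ L]
variable {V : Type*} [AddCommGroup V] [Module ℂ V] [LieRingModule L V] [LieModule ℂ L V]
variable {V' : Type*} [AddCommGroup V'] [Module ℂ V'] [LieRingModule L V'] [LieModule ℂ L V']
variable {ι : Type*}

theorem monomialAct_eq (s : List ι) (f : ι → L) (m : ι →₀ ℕ) (v : V) :
    monomialAct s f m v = (s.map fun i => LieModule.toEnd ℂ L V (f i) ^ m i).prod v := by
  unfold monomialAct orderedMonomial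
  rw [map_list_prod, List.map_map]
  congr 3
  ext1 i
  simp

@[simp]
theorem monomialAct_nil (f : ι → L) (m : ι →₀ ℕ) (v : V) : monomialAct [] f m v = v := by
  simp [monomialAct_eq]

theorem monomialAct_cons (i : ι) (s : List ι) (f : ι → L) (m : ι →₀ ℕ) (v : V) :
    monomialAct (i :: s) f m v =
      (LieModule.toEnd ℂ L V (f i) ^ m i) (monomialAct s f m v) := by
  simp [monomialAct_eq]

theorem monomialAct_append (s s' : List ι) (f : ι → L) (m : ι →₀ ℕ) (v : V) :
    monomialAct (s ++ s') f m v = monomialAct s f m (monomialAct s' f m v) := by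
  simp [monomialAct_eq]

@[simp]
theorem monomialAct_zero (s : List ι) (f : ι → L) (v : V) : monomialAct s f 0 v = v := by
  induction s with
  | nil => simp
  | cons i s ih => simp [monomialAct_cons, ih]

theorem map_monomialAct (φ : V →ₗ⁅ℂ,L⁆ V') (s : List ι) (f : ι → L) (m : ι →₀ ℕ) (v : V) :
    φ (monomialAct s f m v) = monomialAct s f m (φ v) := by
  induction s with
  | nil => simp
  | cons i s ih =>
    rw [monomialAct_cons, monomialAct_cons, ← ih]
    generalize m i = n
    induction n with
    | zero => simp
    | succ n ihn => simp [pow_succ', ihn]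

theorem monomialAct_induction {p : V → Prop} {s : List ι} {f : ι → L}
    (hf : ∀ i u, p u → p ⁅f i, u⁆) {v : V} (hv : p v) (m : ι →₀ ℕ) : p (monomialAct s f m v) := by
  induction s with
  | nil => simpa
  | cons i s ih =>
    rw [monomialAct_cons]
    generalize m i = n
    induction n with
    | zero => simpa
    | succ n ihn => simpa [pow_succ'] using hf i _ ihn

/-- The span of the vectors `m v`. -/
def monomialSpan (s : List ι) (f : ι → L) (v : V) : Submodule ℂ V :=
  Submodule.span ℂ (Set.range fun m : ι →₀ ℕ => monomialAct s f m v)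

theorem monomialAct_mem_monomialSpan (s : List ι) (f : ι → L) (m : ι →₀ ℕ) (v : V) :
    monomialAct s f m v ∈ monomialSpan s f v :=
  Submodule.subset_span ⟨m, rfl⟩

theorem self_mem_monomialSpan (s : List ι) (f : ι → L) (v : V) : v ∈ monomialSpan s f v := by
  simpa using monomialAct_mem_monomialSpan s f 0 v

theorem monomialSpan_le {s : List ι} {f : ι → L} {v : V} {E : Submodule ℂ V}
    (hf : ∀ i, ∀ u ∈ E, ⁅f i, u⁆ ∈ E) (hv : v ∈ E) : monomialSpan s f v ≤ E := by
  unfold monomialSpan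
  rw [Submodule.span_le]
  rintro _ ⟨m, rfl⟩
  exact monomialAct_induction hf hv m

/-- `f i` times an ordered monomial is a word in the operators of the family, which straightens
inside `Module.End ℂ V`. -/
theorem lie_mem_monomialSpan {s : List ι} (hs : s.Nodup) (hs' : ∀ i, i ∈ s) {f : ι → L}
    (hf : ∀ i j, ⁅f i, f j⁆ ∈ Submodule.span ℂ (Set.range f)) (v : V) (i : ι) {u : V}
    (hu : u ∈ monomialSpan s f v) : ⁅f i, u⁆ ∈ monomialSpan s f v := by
  classical
  set x : ι → Module.End ℂ V := fun i => LieModule.toEnd ℂ L V (f i)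
  have hx (i j) : x i * x j - x j * x i ∈ Submodule.span ℂ (Set.range x) := by
    have h1 : x i * x j - x j * x i = LieModule.toEnd ℂ L V ⁅f i, f j⁆ := by
      ext u
      simp [x]
    rw [h1]
    have h2 := Submodule.mem_map_of_mem
      (f := (LieModule.toEnd ℂ L V : L →ₗ[ℂ] Module.End ℂ V)) (hf i j)
    rw [Submodule.map_span, ← Set.range_comp] at h2
    exact h2
  suffices monomialSpan s f v ≤ (monomialSpan s f v).comap (x i) from this hu
  conv_lhs => unfold monomialSpan
  rw [Submodule.span_le]
  rintro _ ⟨m, rfl⟩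
  have h3 := prod_map_mem_span_ordered hx hs hs'
    (i :: s.flatMap fun i => List.replicate (m i) i)
  rw [List.map_cons, List.prod_cons, List.prod_map_flatMap_replicate] at h3
  have h4 := Submodule.mem_map_of_mem (f := LinearMap.applyₗ (R := ℂ) v) h3
  rw [Submodule.map_span, ← Set.range_comp] at h4
  have e : (LinearMap.applyₗ (R := ℂ) v ∘ fun m : ι →₀ ℕ => (s.map fun i => x i ^ m i).prod) =
      fun m => monomialAct s f m v := funext fun m => (monomialAct_eq s f m v).symm
  rw [e] at h4
  change x i (monomialAct s f m v) ∈ monomialSpan s f v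
  rw [monomialAct_eq]
  exact h4

section Essential

variable {L : Type*} [LieRing L] [LieAlgebra ℂ L] {ι : Type*}
variable {V : Type*} [AddCommGroup V] [Module ℂ V] [LieRingModule L V] [LieModule ℂ L V]
variable {V' : Type*} [AddCommGroup V'] [Module ℂ V'] [LieRingModule L V'] [LieModule ℂ L V']

theorem lowerSpan_map (φ : V →ₗ⁅ℂ,L⁆ V') (s : List ι) (f : ι → L) (mo : MonomialOrder ι)
    (v : V) (m : ι →₀ ℕ) :
    lowerSpan s f mo (φ v) m = (lowerSpan s f mo v m).map (φ : V →ₗ[ℂ] V') := by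
  unfold lowerSpan
  rw [Submodule.map_span]
  congr 1
  ext u
  constructor
  · rintro ⟨m', hm', rfl⟩
    exact ⟨_, ⟨m', hm', rfl⟩, map_monomialAct φ s f m' v⟩
  · rintro ⟨_, ⟨m', hm', rfl⟩, rfl⟩
    exact ⟨m', hm', map_monomialAct φ s f m' v⟩

theorem essential_map_of_injective (φ : V →ₗ⁅ℂ,L⁆ V') (hφ : Function.Injective φ) (s : List ι)
    (f : ι → L) (mo : MonomialOrder ι) (v : V) :
    essential s f mo (φ v) = essential s f mo v := by
  ext m
  unfold essential
  rw [Set.mem_ofPred_eq, Set.mem_ofPred_eq, lowerSpan_map, ← map_monomialAct]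
  exact not_congr hφ.mem_set_image

end Essential

section Prod

variable {L : Type*} [LieRing L] [LieAlgebra ℂ L]
variable (V : Type*) [AddCommGroup V] [Module ℂ V] [LieRingModule L V] [LieModule ℂ L V]
variable (W : Type*) [AddCommGroup W] [Module ℂ W] [LieRingModule L W] [LieModule ℂ L W]

/-- The direct sum of two Lie modules. -/
instance instLieRingModuleProd : LieRingModule L (V × W) where
  bracket x u := (⁅x, u.1⁆, ⁅x, u.2⁆)
  add_lie _ _ _ := Prod.ext (add_lie _ _ _) (add_lie _ _ _)
  lie_add _ _ _ := Prod.ext (lie_add _ _ _) (lie_add _ _ _)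
  leibniz_lie _ _ _ := Prod.ext (leibniz_lie _ _ _) (leibniz_lie _ _ _)

instance instLieModuleProd : LieModule ℂ L (V × W) where
  smul_lie _ _ _ := Prod.ext (smul_lie _ _ _) (smul_lie _ _ _)
  lie_smul _ _ _ := Prod.ext (lie_smul _ _ _) (lie_smul _ _ _)

variable (L) in
/-- The first projection of a direct sum of Lie modules. -/
def lieFst : V × W →ₗ⁅ℂ,L⁆ V := { LinearMap.fst ℂ V W with map_lie' := rfl }

variable (L) in
/-- The second projection of a direct sum of Lie modules. -/
def lieSnd : V × W →ₗ⁅ℂ,L⁆ W := { LinearMap.snd ℂ V W with map_lie' := rfl }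

end Prod

theorem injective_of_isIrreducible {L M M' : Type*} [LieRing L] [LieAlgebra ℂ L]
    [AddCommGroup M] [Module ℂ M] [LieRingModule L M] [LieModule.IsIrreducible ℂ L M]
    [AddCommGroup M'] [Module ℂ M'] [LieRingModule L M'] [LieModule ℂ L M']
    (φ : M →ₗ⁅ℂ,L⁆ M') {w : M} (hw : φ w ≠ 0) : Function.Injective φ := by
  rw [← LieModuleHom.ker_eq_bot]
  refine (eq_bot_or_eq_top φ.ker).resolve_right fun h => hw ?_
  rw [← LieModuleHom.mem_ker, h]
  trivial

/-! ### Highest weight vectors and the modules they generate. -/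

section HighestWeight

variable {L : Type*} [LieRing L] [LieAlgebra ℂ L] {ι : Type*}

/-- `L` is the sum of the span of the lowering operators `f`, of `H` and of the space `n` of
raising operators, the former being graded by the element `t` of `H`. -/
structure IsTriangular (H : LieSubalgebra ℂ L) (n : Submodule ℂ L) (f : ι → L) (t : L) : Prop where
  mem : t ∈ H
  center_le : ∀ z ∈ LieAlgebra.center ℂ L, z ∈ H
  sup_eq_top : Submodule.span ℂ (Set.range f) ⊔ H.toSubmodule ⊔ n = ⊤
  lowering : ∀ i, ∃ c : ℂ, c.re < 0 ∧ ⁅t, f i⁆ = c • f i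
  lie_mem : ∀ i j, ⁅f i, f j⁆ ∈ Submodule.span ℂ (Set.range f)

variable {H : LieSubalgebra ℂ L} {n : Submodule ℂ L} {f : ι → L} {t : L}
variable {M : Type*} [AddCommGroup M] [Module ℂ M] [LieRingModule L M] [LieModule ℂ L M]

/-- The vectors of `E` that all of `L` sends into `E` are stable under each `f i`, by the Leibniz
rule, and include `w`, by the triangular decomposition; hence they fill `E`. No commutation rule
between raising and lowering operators is needed. -/
theorem IsTriangular.lie_mem_monomialSpan (hT : IsTriangular H n f t) {s : List ι} (hs : s.Nodup)
    (hs' : ∀ i, i ∈ s) {w : M} (hw : ∀ x ∈ H, ∃ c : ℂ, ⁅x, w⁆ = c • w)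
    (hn : ∀ x ∈ n, ⁅x, w⁆ = 0) (x : L) {u : M} (hu : u ∈ monomialSpan s f w) :
    ⁅x, u⁆ ∈ monomialSpan s f w := by
  set E := monomialSpan s f w with hE
  have hfE (i : ι) (u : M) (hu : u ∈ E) : ⁅f i, u⁆ ∈ E :=
    FFLVBranching.lie_mem_monomialSpan hs hs' hT.lie_mem w i hu
  have hw₀ : w ∈ E := self_mem_monomialSpan s f w
  let E' : Submodule ℂ M :=
    { carrier := {u | u ∈ E ∧ ∀ x : L, ⁅x, u⁆ ∈ E}
      add_mem' := fun ha hb => ⟨E.add_mem ha.1 hb.1, fun x => by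
        rw [lie_add]; exact E.add_mem (ha.2 x) (hb.2 x)⟩
      zero_mem' := ⟨E.zero_mem, fun x => by simp⟩
      smul_mem' := fun c u hu => ⟨E.smul_mem c hu.1, fun x => by
        rw [lie_smul]; exact E.smul_mem c (hu.2 x)⟩ }
  have hle : E ≤ E' := by
    refine monomialSpan_le (fun i u hu => ⟨hfE i u hu.1, fun x => ?_⟩) ⟨hw₀, fun x => ?_⟩
    · rw [leibniz_lie]
      exact E.add_mem (hu.2 _) (hfE i _ (hu.2 x))
    · have hx : x ∈ Submodule.span ℂ (Set.range f) ⊔ H.toSubmodule ⊔ n := by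
        rw [hT.sup_eq_top]; trivial
      obtain ⟨y, hy, e, he, rfl⟩ := Submodule.mem_sup.mp hx
      obtain ⟨g, hg, h, hh, rfl⟩ := Submodule.mem_sup.mp hy
      obtain ⟨c, hc⟩ := hw h hh
      rw [add_lie, add_lie, hn e he, hc, add_zero]
      refine E.add_mem ?_ (E.smul_mem c hw₀)
      have : Submodule.span ℂ (Set.range f) ≤
          E.comap ((LieModule.toEnd ℂ L M : L →ₗ[ℂ] Module.End ℂ M).flip w) := by
        rw [Submodule.span_le]
        rintro _ ⟨i, rfl⟩
        exact hfE i w hw₀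
      exact this hg
  exact (hle hu).2 x

theorem toEnd_lie_of_eigenvector {c d : ℂ} {x : L} (hx : ⁅t, x⁆ = c • x) {u : M}
    (hu : u ∈ (LieModule.toEnd ℂ L M t).eigenspace d) :
    ⁅x, u⁆ ∈ (LieModule.toEnd ℂ L M t).eigenspace (c + d) := by
  rw [Module.End.mem_eigenspace_iff, LieModule.toEnd_apply_apply] at hu ⊢
  rw [leibniz_lie, hx, hu, smul_lie, lie_smul, add_smul]

/-- A finite-dimensional module over a reductive Lie algebra that is generated by a highest weight
vector is irreducible. -/
theorem IsTriangular.isIrreducible [FiniteDimensional ℂ L] [LieAlgebra.HasCentralRadical ℂ L]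
    [FiniteDimensional ℂ M] (hT : IsTriangular H n f t) {s : List ι} (hs : s.Nodup)
    (hs' : ∀ i, i ∈ s) {lam : Module.Dual ℂ H} {w : M} (hw : IsWeightVector H lam w)
    (hn : ∀ x ∈ n, ⁅x, w⁆ = 0) (hgen : ∀ N : LieSubmodule ℂ L M, w ∈ N → N = ⊤) :
    LieModule.IsIrreducible ℂ L M := by
  have hwH (x : L) (hx : x ∈ H) : ⁅x, w⁆ = lam ⟨x, hx⟩ • w := hw.2 ⟨x, hx⟩
  have hcentral (z : L) (hz : z ∈ LieAlgebra.center ℂ L) :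
      ∃ c : ℂ, ∀ m : M, ⁅z, m⁆ = c • m := by
    refine ⟨lam ⟨z, hT.center_le z hz⟩, fun m => ?_⟩
    -- Eigenspaces of a central element are submodules; this one contains the generator, so the
    -- centre acts by scalars, as complete reducibility requires.
    let N : LieSubmodule ℂ L M :=
      { (LieModule.toEnd ℂ L M z).eigenspace (lam ⟨z, hT.center_le z hz⟩) with
        lie_mem := fun {x m} hm => by
          have h0 : ⁅z, x⁆ = (0 : ℂ) • x := by rw [← lie_skew, hz x]; simp
          have := toEnd_lie_of_eigenvector h0 hm
          rwa [zero_add] at this }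
    have hN : N = ⊤ := hgen N (Module.End.mem_eigenspace_iff.mpr (hwH z _))
    have hm : m ∈ N := by rw [hN]; trivial
    exact Module.End.mem_eigenspace_iff.mp hm
  set T := LieModule.toEnd ℂ L M t with hTdef
  set a := lam ⟨t, hT.mem⟩
  have hwa : w ∈ T.eigenspace a := Module.End.mem_eigenspace_iff.mpr (hwH t hT.mem)
  -- Lowering operators strictly decrease the real part of the `t`-eigenvalue, so the eigenspace of
  -- `a` is the line through `w`.
  let Low : Submodule ℂ M := ⨆ c : ℂ, ⨆ _ : c.re < a.re, T.eigenspace c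
  have hLow (i : ι) (u : M) (hu : u ∈ Low) : ⁅f i, u⁆ ∈ Low := by
    obtain ⟨c, hc, hci⟩ := hT.lowering i
    have : Low ≤ Low.comap (LieModule.toEnd ℂ L M (f i)) := by
      refine iSup₂_le fun d hd u hu => ?_
      refine Submodule.mem_iSup_of_mem (c + d) (Submodule.mem_iSup_of_mem ?_ ?_)
      · rw [Complex.add_re]; linarith
      · exact toEnd_lie_of_eigenvector hci hu
    exact this hu
  have hspan : monomialSpan s f w ≤ Submodule.span ℂ {w} ⊔ Low := by
    refine monomialSpan_le (fun i u hu => ?_)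
      (Submodule.mem_sup_left (Submodule.mem_span_singleton_self w))
    obtain ⟨y, hy, l, hl, rfl⟩ := Submodule.mem_sup.mp hu
    obtain ⟨b, rfl⟩ := Submodule.mem_span_singleton.mp hy
    obtain ⟨c, hc, hci⟩ := hT.lowering i
    refine Submodule.mem_sup_right ?_
    rw [lie_add, lie_smul]
    refine Low.add_mem (Low.smul_mem b ?_) (hLow i l hl)
    refine Submodule.mem_iSup_of_mem (c + a) (Submodule.mem_iSup_of_mem ?_ ?_)
    · rw [Complex.add_re]; linarith
    · exact toEnd_lie_of_eigenvector hci hwa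
  let Y : LieSubmodule ℂ L M :=
    { monomialSpan s f w with
      lie_mem := fun {x m} hm =>
        hT.lie_mem_monomialSpan hs hs' (fun x hx => ⟨_, hwH x hx⟩) hn x hm }
  have hY : Y = ⊤ := hgen Y (self_mem_monomialSpan s f w)
  have hdisj : Disjoint (T.eigenspace a) Low := by
    refine (T.eigenspaces_iSupIndep a).mono_right (iSup₂_le fun c hc => ?_)
    refine le_iSup₂_of_le c ?_ le_rfl
    rintro rfl
    exact lt_irrefl _ hc
  have heig (x : M) (hx : x ∈ T.eigenspace a) : ∃ c : ℂ, x = c • w := by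
    have hxY : x ∈ Y := by rw [hY]; trivial
    obtain ⟨y, hy, l, hl, rfl⟩ := Submodule.mem_sup.mp (hspan hxY)
    obtain ⟨b, rfl⟩ := Submodule.mem_span_singleton.mp hy
    have hl' : l ∈ T.eigenspace a := by
      have := Submodule.sub_mem _ hx (Submodule.smul_mem _ b hwa)
      rwa [add_sub_cancel_left] at this
    refine ⟨b, ?_⟩
    rw [(Submodule.disjoint_def.mp hdisj) l hl' hl, add_zero]
  have : Nontrivial M := ⟨⟨w, 0, hw.1⟩⟩
  refine LieModule.IsIrreducible.mk fun N hN => ?_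
  -- Both components of `w` along `N ⊕ N'` are `a`-eigenvectors, so the `N`-component is a multiple
  -- of `w`: the generator lies in `N` or in `N'`.
  obtain ⟨N', hN'⟩ := LieAlgebra.exists_isCompl_of_hasCentralRadical hcentral N
  have hwN : w ∈ N ⊔ N' := by rw [hN'.sup_eq_top]; trivial
  obtain ⟨p, hp, q, hq, hpq⟩ := (LieSubmodule.mem_sup _ _ _).mp hwN
  have hpa : p ∈ T.eigenspace a := by
    rw [Module.End.mem_eigenspace_iff, ← sub_eq_zero]
    have h1 : T p - a • p ∈ N := N.sub_mem (N.lie_mem hp) (N.smul_mem a hp)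
    have h2 : T p - a • p ∈ N' := by
      have h3 : T p - a • p = -(T q - a • q) := by
        have h4 := Module.End.mem_eigenspace_iff.mp hwa
        rw [← hpq, map_add, smul_add] at h4
        rw [eq_neg_iff_add_eq_zero, sub_add_sub_comm, h4, sub_self]
      rw [h3]
      exact N'.neg_mem (N'.sub_mem (N'.lie_mem hq) (N'.smul_mem a hq))
    have : T p - a • p ∈ N ⊓ N' := ⟨h1, h2⟩
    rwa [hN'.inf_eq_bot, LieSubmodule.mem_bot] at this
  obtain ⟨c, hc⟩ := heig p hpa
  by_cases hc0 : c = 0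
  · rw [hc0, zero_smul] at hc
    rw [hc, zero_add] at hpq
    have := hgen N' (hpq ▸ hq)
    rw [this] at hN'
    exact absurd (by simpa using hN'.inf_eq_bot) hN
  · refine hgen N ?_
    have := N.smul_mem c⁻¹ hp
    rwa [hc, smul_smul, inv_mul_cancel₀ hc0, one_smul] at this

/-- A highest weight vector of a finite-dimensional module generates an irreducible submodule. -/
theorem IsTriangular.exists_isHighestWeightModule [FiniteDimensional ℂ L]
    [LieAlgebra.HasCentralRadical ℂ L] [FiniteDimensional ℂ M] (hT : IsTriangular H n f t)
    {s : List ι} (hs : s.Nodup) (hs' : ∀ i, i ∈ s) {lam : Module.Dual ℂ H} {w : M}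
    (hw : IsWeightVector H lam w) (hn : ∀ x ∈ n, ⁅x, w⁆ = 0) :
    ∃ (N : LieSubmodule ℂ L M) (hwN : w ∈ N),
      IsHighestWeightModule H n lam (⟨w, hwN⟩ : N) := by
  let N : LieSubmodule ℂ L M :=
    { monomialSpan s f w with
      lie_mem := fun {x m} hm =>
        hT.lie_mem_monomialSpan hs hs' (fun x hx => ⟨_, hw.2 ⟨x, hx⟩⟩) hn x hm }
  have hwN : w ∈ N := self_mem_monomialSpan s f w
  have hw' : IsWeightVector H lam (⟨w, hwN⟩ : N) :=
    ⟨fun h => hw.1 (congrArg Subtype.val h), fun x => Subtype.ext (hw.2 x)⟩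
  have hn' : ∀ x ∈ n, ⁅x, (⟨w, hwN⟩ : N)⁆ = 0 := fun x hx => Subtype.ext (hn x hx)
  refine ⟨N, hwN, inferInstance, hT.isIrreducible hs hs' hw' hn' fun P hP => ?_, hw', hn'⟩
  rw [eq_top_iff]
  rintro ⟨u, hu⟩ -
  have h1 : monomialSpan s f w ≤ (P.map N.incl).toSubmodule :=
    monomialSpan_le (fun i u hu => (P.map N.incl).lie_mem hu)
      (LieSubmodule.mem_map_of_mem (f := N.incl) hP)
  obtain ⟨y, hy, hyu⟩ := (LieSubmodule.mem_map _).mp (h1 hu)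
  have : y = ⟨u, hu⟩ := Subtype.ext hyu
  rwa [← this]

/-- The essential monomials depend only on the highest weight. -/
theorem IsTriangular.essential_eq [FiniteDimensional ℂ L] [LieAlgebra.HasCentralRadical ℂ L]
    {M' : Type*} [AddCommGroup M'] [Module ℂ M'] [LieRingModule L M'] [LieModule ℂ L M']
    (hT : IsTriangular H n f t) {s : List ι} (hs : s.Nodup) (hs' : ∀ i, i ∈ s)
    (mo : MonomialOrder ι) {lam : Module.Dual ℂ H} {w : M} {w' : M'}
    (hw : IsHighestWeightModule H n lam w) (hw' : IsHighestWeightModule H n lam w') :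
    essential s f mo w = essential s f mo w' := by
  have := hw.finiteDimensional
  have := hw'.finiteDimensional
  -- The diagonal vector generates an irreducible submodule of the direct sum. Both projections are
  -- nonzero on it, hence injective, and preserve essential monomials.
  have h1 : IsWeightVector H lam (w, w') :=
    ⟨fun h => hw.weight.1 (congrArg Prod.fst h),
      fun x => Prod.ext (hw.weight.2 x) (hw'.weight.2 x)⟩
  obtain ⟨N, hN, hNw⟩ := hT.exists_isHighestWeightModule hs hs' h1
    fun x hx => Prod.ext (hw.raising x hx) (hw'.raising x hx)
  have := hNw.irreducible
  have e1 := essential_map_of_injective ((lieFst L M M').comp N.incl)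
    (injective_of_isIrreducible _ (w := ⟨(w, w'), hN⟩) hw.weight.1) s f mo ⟨(w, w'), hN⟩
  have e2 := essential_map_of_injective ((lieSnd L M M').comp N.incl)
    (injective_of_isIrreducible _ (w := ⟨(w, w'), hN⟩) hw'.weight.1) s f mo ⟨(w, w'), hN⟩
  exact e1.trans e2.symm

end HighestWeight

end FFLVBranching

/-! ### Semisimplicity of the action of a Cartan subalgebra. -/

namespace LieAlgebra

open LieModule Module

variable {K L : Type*} [Field K] [LieRing L] [LieAlgebra K L]

theorem center_le_of_isCartanSubalgebra (H : LieSubalgebra K L) [H.IsCartanSubalgebra] {z : L}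
    (hz : z ∈ center K L) : z ∈ H := by
  have h : z ∈ H.normalizer := by
    rw [LieSubalgebra.mem_normalizer_iff]
    intro y _
    rw [← lie_skew, hz y, neg_zero]
    exact H.zero_mem
  rwa [LieSubalgebra.IsCartanSubalgebra.self_normalizing] at h

/-- A Cartan subalgebra of a reductive Lie algebra acts semisimply in the adjoint
representation. -/
theorem lie_eq_smul_of_mem_rootSpace_of_hasCentralRadical [CharZero K] [IsAlgClosed K]
    [FiniteDimensional K L] [HasCentralRadical K L] (H : LieSubalgebra K L)
    [H.IsCartanSubalgebra] {α : H → K} {x : L} (hx : x ∈ rootSpace H α) (h : H) :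
    ⁅(h : L), x⁆ = α h • x := by
  obtain ⟨S, hS, _⟩ := exists_isCompl_center (K := K) (L := L)
  have hdec (y : L) : ∃ s : S, ∃ z ∈ center K L, (s : L) + z = y := by
    have hy : y ∈ S ⊔ center K L := by rw [hS.sup_eq_top]; trivial
    obtain ⟨s, hs, z, hz, hsz⟩ := (LieSubmodule.mem_sup _ _ _).mp hy
    exact ⟨⟨s, hs⟩, z, hz, hsz⟩
  -- The Cartan subalgebra contains the centre, so its trace on `S` is a Cartan subalgebra of a
  -- semisimple algebra, where ad-semisimplicity is known.
  let HS : LieSubalgebra K S := H.comap S.incl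
  have : HS.IsCartanSubalgebra := by
    let g : HS →ₗ⁅K⁆ H :=
      { toFun := fun y => ⟨(y : S), y.2⟩
        map_add' := fun _ _ => rfl
        map_smul' := fun _ _ => rfl
        map_lie' := rfl }
    have hg : Function.Injective g := fun y y' e =>
      Subtype.ext (Subtype.ext (congrArg (Subtype.val : H → L) e))
    refine ⟨hg.lieAlgebra_isNilpotent, le_antisymm (fun y hy => ?_) HS.le_normalizer⟩
    rw [LieSubalgebra.mem_normalizer_iff] at hy
    have h1 : (y : L) ∈ H.normalizer := by
      rw [LieSubalgebra.mem_normalizer_iff]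
      intro a ha
      obtain ⟨s, z, hz, rfl⟩ := hdec a
      have hs : s ∈ HS := by
        have := H.sub_mem ha (center_le_of_isCartanSubalgebra H hz)
        rwa [add_sub_cancel_right] at this
      rw [lie_add, hz, add_zero]
      exact hy s hs
    rwa [LieSubalgebra.IsCartanSubalgebra.self_normalizing] at h1
  obtain ⟨hs, hz, hzc, hsz⟩ := hdec h
  have hsH : hs ∈ HS := by
    have := H.sub_mem h.2 (center_le_of_isCartanSubalgebra H hzc)
    rwa [← hsz, add_sub_cancel_right] at this
  obtain ⟨s, z, hzc', rfl⟩ := hdec x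
  set c := α h
  have hlie (a : S) : ⁅(h : L), (a : L)⁆ = (⁅hs, a⁆ : S) := by
    have : ⁅hz, (a : L)⁆ = 0 := by rw [← lie_skew, hzc, neg_zero]
    rw [← hsz, add_lie, this, add_zero]
    rfl
  -- `ad h - c` respects the splitting into `S` and the centre and is multiplication by `-c` on the
  -- centre; the central part of `x` thus vanishes unless `c = 0`.
  have hpow (k : ℕ) : ((ad K L h - c • 1) ^ k) ((s : L) + z) =
      (((ad K S hs - c • 1) ^ k) s : S) + (-c) ^ k • z := by
    induction k with
    | zero => simp
    | succ k ih =>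
      rw [pow_succ', Module.End.mul_apply, ih, pow_succ' (ad K S hs - c • 1), Module.End.mul_apply,
        pow_succ' (-c)]
      generalize ((ad K S hs - c • 1) ^ k) s = a
      simp only [LinearMap.sub_apply, ad_apply, LinearMap.smul_apply, Module.End.one_apply,
        lie_add, hlie, lie_smul, hzc' (h : L)]
      push_cast
      simp only [mul_smul, neg_smul, smul_add, smul_zero, add_zero]
      abel
  have hx' : ((s : L) + z) ∈ (ad K L h).maxGenEigenspace c :=
    genWeightSpace_le_genWeightSpaceOf L h α hx
  rw [Module.End.mem_maxGenEigenspace] at hx'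
  obtain ⟨k, hk⟩ := hx'
  rw [hpow] at hk
  have hk1 : ((((ad K S hs - c • 1) ^ k) s : S) : L) ∈ S ⊓ center K L := by
    refine ⟨Subtype.property _, ?_⟩
    rw [eq_neg_of_add_eq_zero_left hk]
    exact (center K L).neg_mem ((center K L).smul_mem _ hzc')
  rw [hS.inf_eq_bot, LieSubmodule.mem_bot] at hk1
  rw [hk1, zero_add] at hk
  have hs1 : s ∈ (ad K S hs).maxGenEigenspace c := by
    rw [Module.End.mem_maxGenEigenspace]
    exact ⟨k, Subtype.ext hk1⟩
  rw [(IsKilling.isSemisimple_ad_of_mem_isCartanSubalgebra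
    hsH).isFinitelySemisimple.maxGenEigenspace_eq_eigenspace, Module.End.mem_eigenspace_iff,
    ad_apply] at hs1
  have hz1 : c • z = 0 := by
    rcases smul_eq_zero.mp hk with h0 | h0
    · rw [neg_eq_zero.mp (eq_zero_of_pow_eq_zero h0), zero_smul]
    · rw [h0, smul_zero]
  rw [lie_add, hlie, hs1, hzc', smul_add, hz1]
  rfl

end LieAlgebra

/-! ### Triangular decompositions of `𝔤` and `𝔤₀`. -/

namespace FFLVBranching

open LieAlgebra

/-- If `A u = a u`, the relation gives `(A - a) T u = -(c a) u`, so `T u` is a generalised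
eigenvector of `A`. Semisimplicity makes it an eigenvector, forcing `a = 0`. -/
theorem eq_zero_of_isSemisimple_of_lie_eq_smul {E : Type*} [AddCommGroup E] [Module ℂ E]
    [FiniteDimensional ℂ E] {T A : Module.End ℂ E} (hA : A.IsSemisimple) {c : ℂ} (hc : c ≠ 0)
    (h : T * A - A * T = c • A) : A = 0 := by
  refine hA.eq_zero_iff_forall_eigenvalue.mpr fun a ha => ?_
  obtain ⟨u, hu, hu0⟩ := ha.exists_hasEigenvector
  rw [Module.End.mem_eigenspace_iff] at hu
  have h1 : A (T u) - a • T u = -(c * a) • u := by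
    have := LinearMap.congr_fun h u
    simp only [LinearMap.sub_apply, Module.End.mul_apply, hu, map_smul, LinearMap.smul_apply]
      at this
    rw [smul_smul] at this
    rw [neg_smul, ← this]
    abel
  have h2 : T u ∈ A.maxGenEigenspace a := by
    rw [Module.End.mem_maxGenEigenspace]
    refine ⟨2, ?_⟩
    rw [pow_two, Module.End.mul_apply]
    have e : (A - a • 1) (T u) = -(c * a) • u := h1
    rw [e, map_smul, LinearMap.sub_apply, hu]
    simp
  rw [hA.isFinitelySemisimple.maxGenEigenspace_eq_eigenspace, Module.End.mem_eigenspace_iff] at h2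
  rw [h2, sub_self, eq_comm, smul_eq_zero, neg_eq_zero, mul_eq_zero] at h1
  tauto

variable {𝔤 : Type u} [LieRing 𝔤] [LieAlgebra ℂ 𝔤]
variable {H : LieSubalgebra ℂ 𝔤} [H.IsCartanSubalgebra]

/-- `t` is an element of the Cartan subalgebra that defines the positive system `P`. -/
def IsDefiningElement (P : Set (LieModule.Weight ℂ H 𝔤)) (t : H) : Prop :=
  ∀ α : LieModule.Weight ℂ H 𝔤,
    (α.IsNonZero → (α t).im = 0 ∧ (α t).re ≠ 0) ∧ (α ∈ P ↔ α.IsNonZero ∧ 0 < (α t).re)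

variable {P : Set (LieModule.Weight ℂ H 𝔤)} {t : H}

theorem IsDefiningElement.re_neg (ht : IsDefiningElement P t) {α : LieModule.Weight ℂ H 𝔤}
    (hα : α ∈ negRoots H P) : (α t).re < 0 := by
  refine lt_of_le_of_ne (not_lt.mp fun h => hα.2 ((ht α).2.mpr ⟨hα.1, h⟩)) ((ht α).1 hα.1).2

theorem rootSpace_le_rootSum {α : LieModule.Weight ℂ H 𝔤} (hα : α ∈ P) :
    (rootSpace H α).toSubmodule ≤ rootSum H P := by
  unfold rootSum
  exact le_iSup₂_of_le α hα le_rfl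

variable [FiniteDimensional ℂ 𝔤]

theorem iSup_rootSpace_eq_top :
    ⨆ α : LieModule.Weight ℂ H 𝔤, (rootSpace H α).toSubmodule = ⊤ := by
  have := LieModule.iSup_genWeightSpace_eq_top' ℂ H 𝔤
  rw [← LieSubmodule.toSubmodule_inj, LieSubmodule.iSup_toSubmodule] at this
  exact this

variable [HasCentralRadical ℂ 𝔤]

/-- The lowering operators map weight vectors to weight vectors. -/
theorem exists_weight_lie {V : Type*} [AddCommGroup V] [Module ℂ V]
    [LieRingModule 𝔤 V] [LieModule ℂ 𝔤 V] {α : LieModule.Weight ℂ H 𝔤} {x : 𝔤}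
    (hx : x ∈ rootSpace H α) {u : V} (hu : ∃ μ : Module.Dual ℂ H, ∀ h : H, ⁅(h : 𝔤), u⁆ = μ h • u) :
    ∃ μ : Module.Dual ℂ H, ∀ h : H, ⁅(h : 𝔤), ⁅x, u⁆⁆ = μ h • ⁅x, u⁆ := by
  obtain ⟨μ, hμ⟩ := hu
  refine ⟨α.toLinear + μ, fun h => ?_⟩
  rw [leibniz_lie, lie_eq_smul_of_mem_rootSpace_of_hasCentralRadical H hx, hμ, smul_lie, lie_smul,
    LinearMap.add_apply, add_smul]
  rfl

theorem rootSpace_le_eigenspace (t : H) (α : LieModule.Weight ℂ H 𝔤) :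
    (rootSpace H α).toSubmodule ≤ (ad ℂ 𝔤 t).eigenspace (α t) := fun _ hx =>
  Module.End.mem_eigenspace_iff.mpr (lie_eq_smul_of_mem_rootSpace_of_hasCentralRadical H hx t)

theorem eigenspace_le_iSup_rootSpace (t : H) (c : ℂ) :
    (ad ℂ 𝔤 t).eigenspace c ≤
      ⨆ α : LieModule.Weight ℂ H 𝔤, ⨆ _ : α t = c, (rootSpace H α).toSubmodule := by
  intro x hx
  set A := ⨆ α : LieModule.Weight ℂ H 𝔤, ⨆ _ : α t = c, (rootSpace H α).toSubmodule
  set B := ⨆ d : ℂ, ⨆ _ : d ≠ c, (ad ℂ 𝔤 t).eigenspace d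
  have hAB : x ∈ A ⊔ B := by
    suffices ⊤ ≤ A ⊔ B from this trivial
    rw [← iSup_rootSpace_eq_top (H := H)]
    refine iSup_le fun α => ?_
    by_cases h : α t = c
    · exact le_sup_of_le_left (le_iSup₂_of_le α h le_rfl)
    · exact le_sup_of_le_right (le_iSup₂_of_le (α t) h (rootSpace_le_eigenspace t α))
  obtain ⟨a, ha, b, hb, rfl⟩ := Submodule.mem_sup.mp hAB
  have hA : A ≤ (ad ℂ 𝔤 t).eigenspace c := iSup₂_le fun α h => h ▸ rootSpace_le_eigenspace t α
  have hb' : b ∈ (ad ℂ 𝔤 t).eigenspace c := by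
    have := Submodule.sub_mem _ hx (hA ha)
    rwa [add_sub_cancel_left] at this
  have := (Submodule.disjoint_def.mp ((ad ℂ 𝔤 t).eigenspaces_iSupIndep c)) b hb' hb
  rwa [this, add_zero]

theorem IsDefiningElement.eigenspace_le_nPos (ht : IsDefiningElement P t) {c : ℂ} (hc : 0 < c.re) :
    (ad ℂ 𝔤 t).eigenspace c ≤ nPos H P := by
  refine (eigenspace_le_iSup_rootSpace t c).trans (iSup₂_le fun α h => ?_)
  subst h
  refine rootSpace_le_rootSum ?_
  refine (ht α).2.mpr ⟨fun h0 => ?_, hc⟩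
  rw [h0.eq] at hc
  simp at hc

theorem IsDefiningElement.eigenspace_le_nNeg (ht : IsDefiningElement P t) {c : ℂ} (hc : c.re < 0) :
    (ad ℂ 𝔤 t).eigenspace c ≤ nNeg H P := by
  refine (eigenspace_le_iSup_rootSpace t c).trans (iSup₂_le fun α h => ?_)
  subst h
  refine rootSpace_le_rootSum ?_
  refine ⟨fun h0 => ?_, fun h0 => ?_⟩
  · rw [h0.eq] at hc
    simp at hc
  · exact lt_asymm hc ((ht α).2.mp h0).2

/-- No nonzero root takes a value with zero real part at `t`, so only the zero root space, which is
`H`, contributes. -/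
theorem IsDefiningElement.eigenspace_le_cartan (ht : IsDefiningElement P t) {c : ℂ}
    (hc : c.re = 0) : (ad ℂ 𝔤 t).eigenspace c ≤ H.toSubmodule := by
  refine (eigenspace_le_iSup_rootSpace t c).trans (iSup₂_le fun α h => ?_)
  subst h
  have h0 : α.IsZero := by
    by_contra h
    exact ((ht α).1 h).2 hc
  rw [h0.eq, rootSpace_zero_eq]
  exact le_rfl

theorem iSup_eigenspace_eq_top (t : H) : ⨆ c : ℂ, (ad ℂ 𝔤 t).eigenspace c = ⊤ := by
  rw [eq_top_iff, ← iSup_rootSpace_eq_top (H := H)]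
  exact iSup_le fun α => le_iSup_of_le (α t) (rootSpace_le_eigenspace t α)

/-- A subspace normalised by the Cartan subalgebra has a triangular decomposition. -/
theorem IsDefiningElement.le_sup_inf (ht : IsDefiningElement P t) {E : Submodule ℂ 𝔤}
    (hE : ∀ y ∈ E, ⁅(t : 𝔤), y⁆ ∈ E) :
    E ≤ (nNeg H P ⊓ E) ⊔ (H.toSubmodule ⊓ E) ⊔ (nPos H P ⊓ E) := by
  have h1 : E = ⨆ c : ℂ, E ⊓ (ad ℂ 𝔤 t).eigenspace c :=
    Submodule.eq_iSup_inf_genEigenspace 1 hE (iSup_eigenspace_eq_top t)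
  conv_lhs => rw [h1]
  refine iSup_le fun c => ?_
  rcases lt_trichotomy c.re 0 with hc | hc | hc
  · exact le_sup_of_le_left (le_sup_of_le_left
      (le_inf (inf_le_right.trans (ht.eigenspace_le_nNeg hc)) inf_le_left))
  · exact le_sup_of_le_left (le_sup_of_le_right
      (le_inf (inf_le_right.trans (ht.eigenspace_le_cartan hc)) inf_le_left))
  · exact le_sup_of_le_right (le_inf (inf_le_right.trans (ht.eigenspace_le_nPos hc)) inf_le_left)

theorem IsDefiningElement.lie_mem_nNeg (ht : IsDefiningElement P t)
    {α β : LieModule.Weight ℂ H 𝔤} (hα : α ∈ negRoots H P) (hβ : β ∈ negRoots H P) {x y : 𝔤}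
    (hx : x ∈ rootSpace H α) (hy : y ∈ rootSpace H β) : ⁅x, y⁆ ∈ nNeg H P := by
  refine ht.eigenspace_le_nNeg (c := α t + β t) ?_
    (toEnd_lie_of_eigenvector (M := 𝔤) (t := (t : 𝔤))
      (lie_eq_smul_of_mem_rootSpace_of_hasCentralRadical H hx t) (rootSpace_le_eigenspace t β hy))
  have := ht.re_neg hα
  have := ht.re_neg hβ
  rw [Complex.add_re]
  linarith

theorem IsDefiningElement.isTriangular (ht : IsDefiningElement P t) {ι : Type*} {f : ι → 𝔤}
    (hf : IsRootVectorBasis H P (nNeg H P) f) : IsTriangular H (nPos H P) f (t : 𝔤) where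
  mem := t.2
  center_le _ hz := center_le_of_isCartanSubalgebra H hz
  sup_eq_top := by
    rw [hf.span_eq, eq_top_iff]
    simpa using ht.le_sup_inf (E := ⊤) fun _ _ => trivial
  lowering i := by
    obtain ⟨α, hα, hi⟩ := hf.root_vector i
    exact ⟨α t, ht.re_neg hα, lie_eq_smul_of_mem_rootSpace_of_hasCentralRadical H hi t⟩
  lie_mem i j := by
    obtain ⟨α, hα, hi⟩ := hf.root_vector i
    obtain ⟨β, hβ, hj⟩ := hf.root_vector j
    rw [hf.span_eq]
    exact ht.lie_mem_nNeg hα hβ hi hj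

/-- The element `t` need not lie in `𝔤₀`, but `ad t` restricts to a derivation of `𝔤₀` killing its
centre, hence to `ad t₀` with `t₀ ∈ 𝔤₀`. As `[t, t₀] = [t₀, t₀] = 0`, the element `t₀` lies in `H`,
and it grades `𝔤₀` just as `t` does. -/
theorem IsDefiningElement.exists_isTriangular (ht : IsDefiningElement P t)
    {𝔤₀ : LieSubalgebra ℂ 𝔤} (h𝔤₀ : IsReductiveSubalgebra 𝔤₀)
    (hnorm : ∀ x ∈ H, ∀ y ∈ 𝔤₀, ⁅x, y⁆ ∈ 𝔤₀) {ι : Type*} {f₀ : ι → 𝔤₀}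
    (hf₀ : IsRootVectorBasis H P (nNeg H P ⊓ 𝔤₀.toSubmodule) (fun i => (f₀ i : 𝔤))) :
    ∃ t₀ : 𝔤₀, IsTriangular (cartan₀ H 𝔤₀) (inter₀ (nPos H P) 𝔤₀) f₀ t₀ := by
  have := h𝔤₀.reductive
  have hnt : ∀ y ∈ 𝔤₀, ⁅(t : 𝔤), y⁆ ∈ 𝔤₀ := hnorm t t.2
  have hcenter (z : 𝔤₀) (hz : z ∈ center ℂ 𝔤₀) : ⁅(t : 𝔤), (z : 𝔤)⁆ = 0 := by
    let E : Submodule ℂ 𝔤 := (center ℂ 𝔤₀).toSubmodule.map 𝔤₀.toSubmodule.subtype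
    have hE : ∀ y ∈ E, ⁅(t : 𝔤), y⁆ ∈ E := by
      rintro _ ⟨y, hy, rfl⟩
      refine ⟨⟨⁅(t : 𝔤), (y : 𝔤)⁆, hnt y y.2⟩, fun x => Subtype.ext ?_, rfl⟩
      have h1 : ⁅(x : 𝔤), (y : 𝔤)⁆ = 0 := congrArg Subtype.val (hy x)
      have h2 : ⁅⁅(t : 𝔤), (x : 𝔤)⁆, (y : 𝔤)⁆ = 0 :=
        congrArg Subtype.val (hy ⟨⁅(t : 𝔤), (x : 𝔤)⁆, hnt x x.2⟩)
      change ⁅(x : 𝔤), ⁅(t : 𝔤), (y : 𝔤)⁆⁆ = 0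
      rw [leibniz_lie, h1, lie_zero, add_zero, ← lie_skew (x : 𝔤) (t : 𝔤), neg_lie, h2, neg_zero]
    have h1 : E = ⨆ c : ℂ, E ⊓ (ad ℂ 𝔤 t).eigenspace c :=
      Submodule.eq_iSup_inf_genEigenspace 1 hE (iSup_eigenspace_eq_top t)
    have h2 : E ≤ LinearMap.ker (ad ℂ 𝔤 t) := by
      rw [h1]
      refine iSup_le fun c y hy => ?_
      obtain ⟨⟨y, hy, rfl⟩, hyc⟩ := hy
      replace hyc := Module.End.mem_eigenspace_iff.mp hyc
      rw [LinearMap.mem_ker, hyc]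
      by_cases hc : c = 0
      · rw [hc, zero_smul]
      -- A central `t`-eigenvector with nonzero eigenvalue would be both ad-semisimple and shifted
      -- by `ad t`, so its adjoint operator vanishes and it commutes with `t` after all.
      · have h0 : ad ℂ 𝔤 (y : 𝔤) = 0 := by
          refine eq_zero_of_isSemisimple_of_lie_eq_smul (T := ad ℂ 𝔤 t)
            (h𝔤₀.center_semisimple y hy) hc ?_
          have hyc' : ⁅(t : 𝔤), (y : 𝔤)⁆ = c • (y : 𝔤) := hyc
          rw [← map_smul, ← hyc']
          ext x
          simp
        have : ⁅(y : 𝔤), (t : 𝔤)⁆ = 0 := LinearMap.congr_fun h0 t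
        have hyt : ⁅(t : 𝔤), (y : 𝔤)⁆ = 0 := by rw [← lie_skew, this, neg_zero]
        exact hyc.symm.trans hyt
    exact h2 ⟨z, hz, rfl⟩
  let D : 𝔤₀ →ₗ[ℂ] 𝔤₀ := (ad ℂ 𝔤 t).restrict (p := 𝔤₀.toSubmodule) hnt
  obtain ⟨t₀, ht₀⟩ := exists_eq_lie_of_derivation D
    (fun x y => Subtype.ext (leibniz_lie (t : 𝔤) (x : 𝔤) (y : 𝔤)))
    fun z hz => Subtype.ext (hcenter z hz)
  have htt₀ (y : 𝔤₀) : ⁅(t : 𝔤), (y : 𝔤)⁆ = ⁅(t₀ : 𝔤), (y : 𝔤)⁆ := congrArg Subtype.val (ht₀ y)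
  have hker (y : 𝔤) (hy : ⁅(t : 𝔤), y⁆ = 0) : y ∈ H :=
    ht.eigenspace_le_cartan (c := 0) rfl
      (Module.End.mem_eigenspace_iff.mpr (by rw [zero_smul]; exact hy))
  have hspan : (Submodule.span ℂ (Set.range f₀)).map 𝔤₀.toSubmodule.subtype =
      nNeg H P ⊓ 𝔤₀.toSubmodule := by
    rw [Submodule.map_span, ← Set.range_comp, ← hf₀.span_eq]
    rfl
  have hmem (y : 𝔤₀) (hy : (y : 𝔤) ∈ nNeg H P) : y ∈ Submodule.span ℂ (Set.range f₀) := by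
    have : (y : 𝔤) ∈ nNeg H P ⊓ 𝔤₀.toSubmodule := ⟨hy, y.2⟩
    rw [← hspan] at this
    obtain ⟨y', hy', e⟩ := this
    rwa [← Subtype.ext e]
  refine ⟨t₀, hker _ ((htt₀ t₀).trans (lie_self _)), fun z hz => hker _ (hcenter z hz), ?_,
    fun i => ?_, fun i j => ?_⟩
  · rw [eq_top_iff]
    rintro y -
    obtain ⟨a, ha, p, hp, hap⟩ := Submodule.mem_sup.mp
      (ht.le_sup_inf (E := 𝔤₀.toSubmodule) hnt y.2)
    obtain ⟨n, hn, h, hh, rfl⟩ := Submodule.mem_sup.mp ha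
    have : y = ⟨n, hn.2⟩ + ⟨h, hh.2⟩ + ⟨p, hp.2⟩ := Subtype.ext hap.symm
    rw [this]
    refine Submodule.add_mem_sup (Submodule.add_mem_sup (hmem _ hn.1) ?_) ?_
    · exact hh.1
    · exact hp.1
  · obtain ⟨α, hα, hi⟩ := hf₀.root_vector i
    refine ⟨α t, ht.re_neg hα, Subtype.ext ?_⟩
    exact (htt₀ _).symm.trans (lie_eq_smul_of_mem_rootSpace_of_hasCentralRadical H hi t)
  · obtain ⟨α, hα, hi⟩ := hf₀.root_vector i
    obtain ⟨β, hβ, hj⟩ := hf₀.root_vector j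
    exact hmem _ (ht.lie_mem_nNeg hα hβ hi hj)

open LieAlgebra

/-! ### The branching order and its filtration by `𝔤₀`-submodules. -/

section Join

variable {𝔤 : Type u} [LieRing 𝔤] [LieAlgebra ℂ 𝔤] {𝔤₀ : LieSubalgebra ℂ 𝔤} {k l : ℕ}
variable {V : Type w} [AddCommGroup V] [Module ℂ V] [LieRingModule 𝔤 V] [LieModule ℂ 𝔤 V]

theorem exists_eq_joinMonomial (m : Fin k ⊕ Fin l →₀ ℕ) :
    ∃ m₀ m₁, m = joinMonomial m₀ m₁ := by
  refine ⟨(Finsupp.sumFinsuppAddEquivProdFinsupp m).1, (Finsupp.sumFinsuppAddEquivProdFinsupp m).2,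
    ?_⟩
  ext i
  rcases i with i | i <;> simp [joinMonomial]

theorem nodup_factorSeq (k l : ℕ) : (factorSeq k l).Nodup := by
  unfold factorSeq
  refine List.Nodup.append ((List.nodup_finRange k).map Sum.inl_injective)
    ((List.nodup_finRange l).map Sum.inr_injective) ?_
  intro i h₀ h₁
  simp only [List.mem_map] at h₀ h₁
  obtain ⟨a, -, rfl⟩ := h₀
  obtain ⟨b, -, h⟩ := h₁
  exact Sum.inr_ne_inl h

theorem mem_factorSeq (i : Fin k ⊕ Fin l) : i ∈ factorSeq k l := by
  rcases i with i | i <;> simp [factorSeq]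

theorem monomialAct_joinMonomial (f₀ : Fin k → 𝔤₀) (f₁ : Fin l → 𝔤) (m₀ : Fin k →₀ ℕ)
    (m₁ : Fin l →₀ ℕ) (v : V) :
    monomialAct (factorSeq k l) (joinBasis f₀ f₁) (joinMonomial m₀ m₁) v =
      monomialAct (List.finRange k) f₀ m₀ (monomialAct (List.finRange l) f₁ m₁ v) := by
  unfold factorSeq
  rw [monomialAct_append]
  simp only [monomialAct_eq, List.map_map]
  rfl

theorem lowerSpan_zero {L ι : Type*} [LieRing L] [LieAlgebra ℂ L] [LieRingModule L V]
    [LieModule ℂ L V] (s : List ι) (f : ι → L) (mo : MonomialOrder ι) (v : V) :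
    lowerSpan s f mo v 0 = ⊥ := by
  unfold lowerSpan
  rw [Submodule.span_eq_bot]
  rintro _ ⟨m, hm, rfl⟩
  rw [map_zero] at hm
  exact absurd hm (not_lt.mpr (mo.zero_le _))

variable (f₀ : Fin k → 𝔤₀) (f₁ : Fin l → 𝔤) (mo₁ : MonomialOrder (Fin l))

/-- The span of the vectors `m₀' m₁' v` with `m₁' < m₁`. -/
def branchingFiltration (v : V) (m₁ : Fin l →₀ ℕ) : Submodule ℂ V :=
  ⨆ m₁' : Fin l →₀ ℕ, ⨆ _ : m₁' ≺[mo₁] m₁,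
    monomialSpan (List.finRange k) f₀ (monomialAct (List.finRange l) f₁ m₁' v)

theorem lowerSpan_joinMonomial (mo₀ : MonomialOrder (Fin k)) (v : V) (m₀ : Fin k →₀ ℕ)
    (m₁ : Fin l →₀ ℕ) :
    lowerSpan (factorSeq k l) (joinBasis f₀ f₁) (branchingOrder mo₀ mo₁) v (joinMonomial m₀ m₁) =
      branchingFiltration f₀ f₁ mo₁ v m₁ ⊔
        lowerSpan (List.finRange k) f₀ mo₀ (monomialAct (List.finRange l) f₁ m₁ v) m₀ := by
  refine le_antisymm ?_ (sup_le (iSup₂_le fun m₁' h => ?_) ?_)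
  · refine Submodule.span_le.mpr ?_
    rintro _ ⟨m, hm, rfl⟩
    obtain ⟨m₀', m₁', rfl⟩ := exists_eq_joinMonomial m
    rw [monomialAct_joinMonomial]
    rcases (branchingOrder_lt_iff mo₀ mo₁ _ _ _ _).mp hm with h | ⟨rfl, h⟩
    · exact Submodule.mem_sup_left (Submodule.mem_iSup_of_mem m₁' (Submodule.mem_iSup_of_mem h
        (monomialAct_mem_monomialSpan _ _ _ _)))
    · exact Submodule.mem_sup_right (Submodule.subset_span ⟨m₀', h, rfl⟩)
  · refine Submodule.span_le.mpr ?_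
    rintro _ ⟨m₀', rfl⟩
    exact Submodule.subset_span ⟨joinMonomial m₀' m₁',
      (branchingOrder_lt_iff mo₀ mo₁ _ _ _ _).mpr (Or.inl h),
      (monomialAct_joinMonomial f₀ f₁ m₀' m₁' v).symm⟩
  · refine Submodule.span_le.mpr ?_
    rintro _ ⟨m₀', h, rfl⟩
    exact Submodule.subset_span ⟨joinMonomial m₀' m₁,
      (branchingOrder_lt_iff mo₀ mo₁ _ _ _ _).mpr (Or.inr ⟨rfl, h⟩),
      (monomialAct_joinMonomial f₀ f₁ m₀' m₁ v).symm⟩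

theorem monomialSpan_map {L ι V' : Type*} [LieRing L] [LieAlgebra ℂ L] [LieRingModule L V]
    [LieModule ℂ L V] [AddCommGroup V'] [Module ℂ V'] [LieRingModule L V'] [LieModule ℂ L V']
    (φ : V →ₗ⁅ℂ,L⁆ V') (s : List ι) (f : ι → L) (v : V) :
    monomialSpan s f (φ v) = (monomialSpan s f v).map (φ : V →ₗ[ℂ] V') := by
  unfold monomialSpan
  rw [Submodule.map_span, ← Set.range_comp]
  congr 2
  ext1 m
  exact (map_monomialAct φ s f m v).symm

variable {f₀ f₁ mo₁}

/-- The branching filtration consists of `𝔤₀`-submodules. -/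
theorem lie_mem_branchingFiltration {H₀ : LieSubalgebra ℂ 𝔤₀} {n₀ : Submodule ℂ 𝔤₀} {t₀ : 𝔤₀}
    (hT : IsTriangular H₀ n₀ f₀ t₀) {v : V}
    (hH : ∀ m₁, ∀ x ∈ H₀, ∃ c : ℂ, ⁅x, monomialAct (List.finRange l) f₁ m₁ v⁆ =
      c • monomialAct (List.finRange l) f₁ m₁ v)
    (hn : ∀ m₁, ∀ x ∈ n₀, ⁅x, monomialAct (List.finRange l) f₁ m₁ v⁆ ∈
      branchingFiltration f₀ f₁ mo₁ v m₁)
    (m₁ : Fin l →₀ ℕ) (x : 𝔤₀) {u : V} (hu : u ∈ branchingFiltration f₀ f₁ mo₁ v m₁) :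
    ⁅x, u⁆ ∈ branchingFiltration f₀ f₁ mo₁ v m₁ := by
  set w := fun m₁ => monomialAct (List.finRange l) f₁ m₁ v with hw
  set G := branchingFiltration f₀ f₁ mo₁ v with hG
  have hGle {m m' : Fin l →₀ ℕ} (h : m' ≺[mo₁] m) :
      G m' ⊔ monomialSpan (List.finRange k) f₀ (w m') ≤ G m := by
    refine sup_le (iSup₂_le fun m'' h' => ?_) ?_
    · exact le_iSup₂_of_le (f := fun m _ => monomialSpan (List.finRange k) f₀ (w m)) m''
        (h'.trans h) le_rfl
    · exact le_iSup₂_of_le (f := fun m _ => monomialSpan (List.finRange k) f₀ (w m)) m' h le_rfl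
  -- `G m` is the sum of the pieces `G m' + monomialSpan (w m')` with `m' < m`, so stability of
  -- those pieces suffices; well-founded induction then provides it.
  have hstep (m : Fin l →₀ ℕ)
      (ih : ∀ m', m' ≺[mo₁] m → ∀ (x : 𝔤₀), ∀ u ∈ G m' ⊔ monomialSpan (List.finRange k) f₀ (w m'),
        ⁅x, u⁆ ∈ G m' ⊔ monomialSpan (List.finRange k) f₀ (w m'))
      (x : 𝔤₀) (u : V) (hu : u ∈ G m) : ⁅x, u⁆ ∈ G m := by
    suffices G m ≤ (G m).comap (LieModule.toEnd ℂ 𝔤₀ V x) from this hu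
    refine iSup₂_le fun m' h u hu => ?_
    exact hGle h (ih m' h x u (Submodule.mem_sup_right hu))
  refine hstep m₁ (fun m hm => ?_) x u hu
  induction m using (InvImage.wf mo₁.toSyn wellFounded_lt).induction with
  | _ m ih =>
  intro x u hu
  let N : LieSubmodule ℂ 𝔤₀ V :=
    { G m with lie_mem := fun {x u} hu => hstep m (fun m' h => ih m' h (h.trans hm)) x u hu }
  -- Modulo `G m` the vector `w m` is annihilated by the raising operators, so its monomial span is
  -- `𝔤₀`-stable in the quotient. Its image may be zero, which is harmless here.
  let π : V →ₗ⁅ℂ,𝔤₀⁆ V ⧸ N := LieSubmodule.Quotient.mk' N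
  have hπ (u : V) : π u = 0 ↔ u ∈ G m := LieSubmodule.Quotient.mk_eq_zero N
  have h1 (x : 𝔤₀) {y : V ⧸ N} (hy : y ∈ monomialSpan (List.finRange k) f₀ (π (w m))) :
      ⁅x, y⁆ ∈ monomialSpan (List.finRange k) f₀ (π (w m)) := by
    refine hT.lie_mem_monomialSpan (List.nodup_finRange k) (List.mem_finRange) (fun x hx => ?_)
      (fun x hx => ?_) x hy
    · obtain ⟨c, hc⟩ := hH m x hx
      exact ⟨c, by rw [← LieModuleHom.map_lie, hc, map_smul]⟩
    · rw [← LieModuleHom.map_lie, hπ]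
      exact hn m x hx
  have h2 : π u ∈ monomialSpan (List.finRange k) f₀ (π (w m)) := by
    obtain ⟨a, ha, b, hb, rfl⟩ := Submodule.mem_sup.mp hu
    rw [map_add, (hπ a).mpr ha, zero_add, monomialSpan_map]
    exact Submodule.mem_map_of_mem hb
  have h3 := h1 x h2
  rw [monomialSpan_map] at h3
  obtain ⟨b, hb, hbu⟩ := h3
  have h4 : ⁅x, u⁆ - b ∈ G m := by
    rw [← hπ, map_sub, LieModuleHom.map_lie, sub_eq_zero]
    exact hbu.symm
  have := Submodule.add_mem_sup h4 hb
  rwa [sub_add_cancel] at this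

end Join

theorem isRootVectorBasis_joinBasis {𝔤 : Type u} [LieRing 𝔤] [LieAlgebra ℂ 𝔤]
    [FiniteDimensional ℂ 𝔤] {H : LieSubalgebra ℂ 𝔤} [H.IsCartanSubalgebra]
    {P : Set (LieModule.Weight ℂ H 𝔤)} {𝔤₀ : LieSubalgebra ℂ 𝔤} {n 𝔯 : Submodule ℂ 𝔤} {k l : ℕ}
    {f₀ : Fin k → 𝔤₀} {f₁ : Fin l → 𝔤} (hf₀ : IsRootVectorBasis H P n (fun i => (f₀ i : 𝔤)))
    (hf₁ : IsRootVectorBasis H P 𝔯 f₁) (hdisj : Disjoint n 𝔯) :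
    IsRootVectorBasis H P (n ⊔ 𝔯) (joinBasis f₀ f₁) where
  linearIndependent := hf₀.linearIndependent.sum_type hf₁.linearIndependent
    (by rwa [hf₀.span_eq, hf₁.span_eq])
  span_eq := by
    rw [joinBasis, Set.Sum.elim_range, Submodule.span_union, hf₀.span_eq, hf₁.span_eq]
  root_vector i := by
    rcases i with i | i
    · exact hf₀.root_vector i
    · exact hf₁.root_vector i

end FFLVBranching

/-! ### The branching theorem. -/

open FFLVBranching in
theorem mainTheorem7
    {𝔤 : Type u} [LieRing 𝔤] [LieAlgebra ℂ 𝔤] [FiniteDimensional ℂ 𝔤]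
    [LieAlgebra.HasCentralRadical ℂ 𝔤]
    (H : LieSubalgebra ℂ 𝔤) [H.IsCartanSubalgebra]
    (P : Set (LieModule.Weight ℂ H 𝔤)) (hP : IsPositiveSystem H P)
    (𝔤₀ : LieSubalgebra ℂ 𝔤) (h𝔤₀ : IsReductiveSubalgebra 𝔤₀)
    (hnorm : ∀ x ∈ H, ∀ y ∈ 𝔤₀, ⁅x, y⁆ ∈ 𝔤₀)
    (𝔯 : Submodule ℂ 𝔤) (h𝔯 : ∀ x ∈ H, ∀ y ∈ 𝔯, ⁅x, y⁆ ∈ 𝔯)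
    (hdisj : Disjoint (nNeg H P ⊓ 𝔤₀.toSubmodule) 𝔯)
    (hsup : (nNeg H P ⊓ 𝔤₀.toSubmodule) ⊔ 𝔯 = nNeg H P)
    {k l : ℕ} (f₀ : Fin k → 𝔤₀) (f₁ : Fin l → 𝔤)
    (hf₀ : IsRootVectorBasis H P (nNeg H P ⊓ 𝔤₀.toSubmodule) (fun i => (f₀ i : 𝔤)))
    (hf₁ : IsRootVectorBasis H P 𝔯 f₁)
    (mo₀ : MonomialOrder (Fin k)) (mo₁ : MonomialOrder (Fin l))
    (hbr : IsBranchingCompatible.{u, w} H (nPos H P) f₀ f₁ mo₀ mo₁)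
    {V : Type w} [AddCommGroup V] [Module ℂ V] [LieRingModule 𝔤 V] [LieModule ℂ 𝔤 V]
    (lam : Module.Dual ℂ H) (v : V) (hv : IsHighestWeightModule H (nPos H P) lam v)
    (m₀ : Fin k →₀ ℕ) (m₁ : Fin l →₀ ℕ) :
    joinMonomial m₀ m₁ ∈
        essential (factorSeq k l) (joinBasis f₀ f₁) (branchingOrder mo₀ mo₁) v ↔
      (lam, m₁) ∈ branchingSemigroup.{u, w} H (nPos H P) f₀ f₁ mo₀ mo₁ ∧
      ∃ μ : Module.Dual ℂ (cartan₀ H 𝔤₀),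
        IsWeightVector (cartan₀ H 𝔤₀) μ
          (monomialAct (factorSeq k l) (joinBasis f₀ f₁) (joinMonomial 0 m₁) v) ∧
        m₀ ∈ ess.{u, w} (List.finRange k) f₀ mo₀ (cartan₀ H 𝔤₀) (inter₀ (nPos H P) 𝔤₀) μ := by
  obtain ⟨t, ht⟩ : ∃ t : H, IsDefiningElement P t := hP
  have hT := ht.isTriangular (hsup ▸ isRootVectorBasis_joinBasis hf₀ hf₁ hdisj)
  obtain ⟨t₀, hT₀⟩ := ht.exists_isTriangular h𝔤₀ hnorm hf₀
  have := h𝔤₀.reductive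
  have := hv.finiteDimensional
  have hs₀ := List.nodup_finRange k
  have hs₀' : ∀ i : Fin k, i ∈ List.finRange k := List.mem_finRange
  set y := fun m => monomialAct (List.finRange l) f₁ m v with hy
  have hjoin (m : Fin l →₀ ℕ) :
      monomialAct (factorSeq k l) (joinBasis f₀ f₁) (joinMonomial 0 m) v = y m := by
    rw [monomialAct_joinMonomial, monomialAct_zero]
  have hweight (m : Fin l →₀ ℕ) :
      ∃ μ : Module.Dual ℂ H, ∀ h : H, ⁅(h : 𝔤), y m⁆ = μ h • y m := by
    refine monomialAct_induction
      (p := fun u : V => ∃ μ : Module.Dual ℂ H, ∀ h : H, ⁅(h : 𝔤), u⁆ = μ h • u)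
      (fun i u hu => ?_) ⟨lam, hv.weight.2⟩ m
    obtain ⟨α, -, hα⟩ := hf₁.root_vector i
    exact exists_weight_lie hα hu
  have hlow (m : Fin l →₀ ℕ) : lowerSpan (factorSeq k l) (joinBasis f₀ f₁)
      (branchingOrder mo₀ mo₁) v (joinMonomial 0 m) = branchingFiltration f₀ f₁ mo₁ v m := by
    rw [lowerSpan_joinMonomial, lowerSpan_zero, sup_bot_eq]
  have hraise (m : Fin l →₀ ℕ) (x : 𝔤₀) (hx : x ∈ inter₀ (nPos H P) 𝔤₀) :
      ⁅x, y m⁆ ∈ branchingFiltration f₀ f₁ mo₁ v m := by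
    -- The compatibility assumption excludes the trivial monomial; there the vector is `v` itself,
    -- killed by all of `𝔫⁺`.
    by_cases hm : m = 0
    · have : ⁅x, y m⁆ = 0 := by
        rw [hm, hy]
        simp only [monomialAct_zero]
        exact hv.raising x hx
      rw [this]
      exact Submodule.zero_mem _
    · have := hbr V lam v hv m hm x hx x.2
      rwa [hlow, hjoin] at this
  let N : LieSubmodule ℂ 𝔤₀ V :=
    { branchingFiltration f₀ f₁ mo₁ v m₁ with
      lie_mem := fun {x u} hu => lie_mem_branchingFiltration hT₀
        (fun m x hx => by
          obtain ⟨μ, hμ⟩ := hweight m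
          exact ⟨μ ⟨x, hx⟩, hμ ⟨x, hx⟩⟩) hraise m₁ x hu }
  let π : V →ₗ⁅ℂ,𝔤₀⁆ V ⧸ N := LieSubmodule.Quotient.mk' N
  have hπ (u : V) : π u = 0 ↔ u ∈ branchingFiltration f₀ f₁ mo₁ v m₁ :=
    LieSubmodule.Quotient.mk_eq_zero N
  have : FiniteDimensional ℂ (V ⧸ N) :=
    inferInstanceAs (FiniteDimensional ℂ (V ⧸ N.toSubmodule))
  have hess (m : Fin k →₀ ℕ) : joinMonomial m m₁ ∈
      essential (factorSeq k l) (joinBasis f₀ f₁) (branchingOrder mo₀ mo₁) v ↔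
      m ∈ essential (List.finRange k) f₀ mo₀ (π (y m₁)) := by
    refine not_congr ?_
    rw [lowerSpan_joinMonomial, monomialAct_joinMonomial, lowerSpan_map, ← map_monomialAct]
    -- The preimage of the image of a subspace is its sum with `N`, which is the form of the lower
    -- span of `m m₁`.
    have := Submodule.comap_map_mkQ N.toSubmodule
      (lowerSpan (List.finRange k) f₀ mo₀ (y m₁) m)
    exact (SetLike.ext_iff.mp this _).symm
  have hess₀ : joinMonomial 0 m₁ ∈
      essential (factorSeq k l) (joinBasis f₀ f₁) (branchingOrder mo₀ mo₁) v ↔ π (y m₁) ≠ 0 := by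
    rw [hess]
    refine not_congr ?_
    rw [monomialAct_zero, lowerSpan_zero, Submodule.mem_bot]
  have hquot (μ : Module.Dual ℂ (cartan₀ H 𝔤₀)) (hμ : IsWeightVector (cartan₀ H 𝔤₀) μ (y m₁))
      (h0 : π (y m₁) ≠ 0) : ∃ (Q : LieSubmodule ℂ 𝔤₀ (V ⧸ N)) (hQ : π (y m₁) ∈ Q),
        IsHighestWeightModule (cartan₀ H 𝔤₀) (inter₀ (nPos H P) 𝔤₀) μ (⟨π (y m₁), hQ⟩ : Q) := by
    refine hT₀.exists_isHighestWeightModule hs₀ hs₀' ⟨h0, fun x => ?_⟩ fun x hx => ?_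
    · rw [← LieModuleHom.map_lie, hμ.2, map_smul]
    · rw [← LieModuleHom.map_lie, hπ]
      exact hraise m₁ x hx
  rw [hjoin, hess]
  constructor
  · intro hm
    have h0 : π (y m₁) ≠ 0 := by
      intro h
      refine hm ?_
      have : monomialAct (List.finRange k) f₀ m₀ (0 : V ⧸ N) = 0 := by
        rw [monomialAct_eq, map_zero]
      rw [h, this]
      exact Submodule.zero_mem _
    refine ⟨⟨V, inferInstance, inferInstance, inferInstance, inferInstance, v, hv,
      hess₀.mpr h0⟩, ?_⟩
    obtain ⟨μ, hμ⟩ := hweight m₁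
    -- The weight of `y m₁` for `𝔥` restricts along this inclusion to its weight for `𝔥₀`.
    let ρ : cartan₀ H 𝔤₀ →ₗ[ℂ] H :=
      { toFun := fun x => ⟨((x : 𝔤₀) : 𝔤), x.2⟩
        map_add' := fun _ _ => rfl
        map_smul' := fun _ _ => rfl }
    have hw : IsWeightVector (cartan₀ H 𝔤₀) (μ ∘ₗ ρ) (y m₁) :=
      ⟨fun h => h0 (by rw [h, map_zero]), fun x => hμ (ρ x)⟩
    obtain ⟨Q, hQ, hQw⟩ := hquot _ hw h0
    refine ⟨μ ∘ₗ ρ, hw, Q, inferInstance, inferInstance, inferInstance, inferInstance,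
      ⟨π (y m₁), hQ⟩, hQw, ?_⟩
    rw [← essential_map_of_injective Q.incl Subtype.val_injective]
    exact hm
  · rintro ⟨⟨V', _, _, _, _, v', hv', hm₁⟩, μ, hμ, M, _, _, _, _, w, hw, hm₀⟩
    -- Membership in the semigroup may be witnessed by another realisation `V'` of the same highest
    -- weight, so essentiality is transferred to `V`.
    have h0 : π (y m₁) ≠ 0 := by
      rw [← hess₀, hT.essential_eq (nodup_factorSeq k l) mem_factorSeq _ hv hv']
      exact hm₁
    obtain ⟨Q, hQ, hQw⟩ := hquot μ hμ h0
    rw [hT₀.essential_eq hs₀ hs₀' mo₀ hw hQw,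
      ← essential_map_of_injective Q.incl Subtype.val_injective] at hm₀
    exact hm₀
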